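/- Let $q=p^d$ be a prime power, $n\ge 1$ an integer with $n\mid q-1$, and let $g=\alpha+b\in\mathbb F_{q^n}$, where $\mathbb F_q(\alpha)=\mathbb F_{q^n}$, $\alpha^n\in\mathbb F_q$ and $b\in\mathbb F_q^*$. For a non-negative integer $e$ let $S_q(e)$ be the sum of the digits of $e$ in base $q$. There is one randomized algorithm for all such data which, given $p,d,n$, an irreducible polynomial $u\in\mathbb F_p[y]$ of degree $dn$ that presents the field as $\mathbb F_{q^n}=\mathbb F_p[y]/(u(y))$, and the elements $g$ and $g^e$ of this field (represented by polynomials in $y$ of degree less than $dn$; $\alpha$ and $b$ are not given), finds $e$ whenever $0\le e<q^n$ and $S_q(e)<n$. It never gives a wrong answer, and its expected running time in bit operations is bounded by a polynomial in $\log(q^n)$. Moreover, such an $e$ is unique: there is no integer $e'\ne e$ with $0\le e'<q^n$, $S_q(e')<n$ and $g^{e'}=g^e$. -/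

import Mathlib

open Polynomial
open scoped ENNReal IntermediateField

/-! ### A probabilistic random access machine with logarithmic (bit) cost -/

namespace RAM

/-- The arithmetic instructions on natural numbers (`sub` is truncated, `div` and `mod` are
quotient and remainder). -/
inductive BinOp
  | add | sub | mul | div | mod

/-- The value of an arithmetic instruction. -/
def BinOp.eval : BinOp → ℕ → ℕ → ℕ
  | .add, a, b => a + b
  | .sub, a, b => a - b
  | .mul, a, b => a * b
  | .div, a, b => a / b
  | .mod, a, b => a % b

/-- The number of bit operations charged for an arithmetic instruction (schoolbook arithmetic);
`Nat.size` is the length in binary. -/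
def BinOp.cost : BinOp → ℕ → ℕ → ℕ
  | .add, a, b => a.size + b.size + 1
  | .sub, a, b => a.size + b.size + 1
  | .mul, a, b => (a.size + 1) * (b.size + 1)
  | .div, a, b => (a.size + 1) * (b.size + 1)
  | .mod, a, b => (a.size + 1) * (b.size + 1)

/-- Programs. A program mentions finitely many registers; the memory is an array of natural
numbers addressed through registers. -/
inductive Prog
  /-- do nothing -/
  | skip : Prog
  /-- `const i c`: put the constant `c` into register `i` -/
  | const (i c : ℕ) : Prog
  /-- `copy i j`: put the content of register `j` into register `i` -/
  | copy (i j : ℕ) : Prog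
  /-- `op o i j k`: apply `o` to registers `j` and `k`, result into register `i` -/
  | op (o : BinOp) (i j k : ℕ) : Prog
  /-- `load i j`: put the memory cell whose address is in register `j` into register `i` -/
  | load (i j : ℕ) : Prog
  /-- `store i j`: put register `j` into the memory cell whose address is in register `i` -/
  | store (i j : ℕ) : Prog
  /-- `flip i`: put a fair random bit into register `i` -/
  | flip (i : ℕ) : Prog
  /-- first `a`, then `b` -/
  | seq (a b : Prog) : Prog
  /-- `a` if register `i` is nonzero, otherwise `b` -/
  | ifNZ (i : ℕ) (a b : Prog) : Prog
  /-- repeat `a` as long as register `i` is nonzero -/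
  | whileNZ (i : ℕ) (a : Prog) : Prog

/-- The data of the machine: registers and memory. -/
structure Store where
  reg : ℕ → ℕ
  mem : ℕ → ℕ

/-- Assignment to a register. -/
def Store.set (s : Store) (i x : ℕ) : Store := { s with reg := Function.update s.reg i x }

/-- A configuration: the stack of program parts that are still to be executed, and the data.
The machine has halted when nothing is left to execute. -/
structure Cfg where
  todo : List Prog
  data : Store

/-- One step of the machine. Each step is supplied with a random bit, which only `flip` uses. -/
def step (coin : Bool) : Cfg → Cfg
  | ⟨[], s⟩ => ⟨[], s⟩
  | ⟨.skip :: r, s⟩ => ⟨r, s⟩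
  | ⟨.const i c :: r, s⟩ => ⟨r, s.set i c⟩
  | ⟨.copy i j :: r, s⟩ => ⟨r, s.set i (s.reg j)⟩
  | ⟨.op o i j k :: r, s⟩ => ⟨r, s.set i (o.eval (s.reg j) (s.reg k))⟩
  | ⟨.load i j :: r, s⟩ => ⟨r, s.set i (s.mem (s.reg j))⟩
  | ⟨.store i j :: r, s⟩ => ⟨r, { s with mem := Function.update s.mem (s.reg i) (s.reg j) }⟩
  | ⟨.flip i :: r, s⟩ => ⟨r, s.set i coin.toNat⟩
  | ⟨.seq a b :: r, s⟩ => ⟨a :: b :: r, s⟩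
  | ⟨.ifNZ i a b :: r, s⟩ => ⟨(if s.reg i ≠ 0 then a else b) :: r, s⟩
  | ⟨.whileNZ i a :: r, s⟩ => ⟨if s.reg i ≠ 0 then a :: .whileNZ i a :: r else r, s⟩

/-- The cost of the next step: the bit lengths of all numbers (and memory addresses) that it
handles. It is `0` exactly when the machine has halted, and at least `1` otherwise. -/
def stepCost : Cfg → ℕ
  | ⟨[], _⟩ => 0
  | ⟨.skip :: _, _⟩ => 1
  | ⟨.const _ c :: _, _⟩ => c.size + 1
  | ⟨.copy _ j :: _, s⟩ => (s.reg j).size + 1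
  | ⟨.op o _ j k :: _, s⟩ => o.cost (s.reg j) (s.reg k)
  | ⟨.load _ j :: _, s⟩ => (s.reg j).size + (s.mem (s.reg j)).size + 1
  | ⟨.store i j :: _, s⟩ => (s.reg i).size + (s.reg j).size + 1
  | ⟨.flip _ :: _, _⟩ => 1
  | ⟨.seq _ _ :: _, _⟩ => 1
  | ⟨.ifNZ i _ _ :: _, s⟩ => (s.reg i).size + 1
  | ⟨.whileNZ i _ :: _, s⟩ => (s.reg i).size + 1

/-- The start: the input is in the memory cells `0, 1, 2, …`, all else is `0`. -/
def start (P : Prog) (input : List ℕ) : Cfg :=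
  ⟨[P], ⟨fun _ => 0, fun i => input.getD i 0⟩⟩

/-- The configuration after `t` steps, when the random bits are `coins 0, coins 1, …`. -/
def run (coins : ℕ → Bool) (c : Cfg) : ℕ → Cfg
  | 0 => c
  | t + 1 => step (coins t) (run coins c t)

/-- The expected cost of the first `t` steps from `c`, with independent fair random bits. -/
noncomputable def expectedCostUpTo : ℕ → Cfg → ℝ≥0∞
  | 0, _ => 0
  | t + 1, c => (stepCost c : ℝ≥0∞)
      + (expectedCostUpTo t (step false c) + expectedCostUpTo t (step true c)) / 2

/-- The expected running time of `P` on `input` (in bit operations). -/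
noncomputable def expectedTime (P : Prog) (input : List ℕ) : ℝ≥0∞ :=
  ⨆ t, expectedCostUpTo t (start P input)

/-- On `input`, whatever the random bits are, `P` never halts with an answer (the content of
register `0`) other than `answer`. -/
def AnswersOnly (P : Prog) (input : List ℕ) (answer : ℕ) : Prop :=
  ∀ (coins : ℕ → Bool) (t : ℕ), (run coins (start P input) t).todo = [] →
    (run coins (start P input) t).data.reg 0 = answer

/-- On `input`, the randomized algorithm `P` finds `answer` in expected time at most `T < ∞`:
it never answers wrongly, and its expected running time is at most `T`. As every step before
halting costs at least `1`, this includes that `P` halts with probability `1`. -/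
def FindsInExpectedTime (P : Prog) (input : List ℕ) (answer T : ℕ) : Prop :=
  AnswersOnly P input answer ∧ expectedTime P input ≤ T

end RAM

/-! ### The discrete logarithm problem -/

/-- The sum of the digits of `e` in base `q`. -/
def digitSum (q e : ℕ) : ℕ := (Nat.digits q e).sum

/-- `g = α + b` with `K = F(α)`, `α ^ n ∈ F` and `b ∈ F`, `b ≠ 0`. -/
def IsKummerShift (F : Type*) {K : Type*} [Field F] [Field K] [Algebra F K] (n : ℕ) (g : K) :
    Prop :=
  ∃ (α : K) (b : F), F⟮α⟯ = ⊤ ∧ α ^ n ∈ (algebraMap F K).range ∧ b ≠ 0 ∧ g = α + algebraMap F K b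

/-- The first `m` coefficients of a polynomial over `ℤ/p`, as numbers in `{0, …, p - 1}`. -/
def coeffList {p : ℕ} (m : ℕ) (f : (ZMod p)[X]) : List ℕ :=
  (List.range m).map fun i => (f.coeff i).val

/-- The instance of the discrete logarithm problem given to the algorithm: `p`, `d` and `n`; the
polynomial `u` of degree `d * n` that defines the field `𝔽_p[y]/(u(y))` with `(p ^ d) ^ n`
elements; and polynomials `v`, `w` of smaller degree that represent the base and the power. -/
def dlogInput (p d n : ℕ) (u v w : (ZMod p)[X]) : List ℕ :=
  [p, d, n] ++ coeffList (d * n + 1) u ++ coeffList (d * n) v ++ coeffList (d * n) w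

set_option linter.unusedSectionVars false
set_option linter.unusedSimpArgs false

/-! ### Coin-free runs of the machine and a weakest-precondition calculus for them. -/

namespace RAM

/-! Write q for the order of F. Since n divides q - 1, the Frobenius map sends α to hα, where h is a
primitive n-th root of unity in F (`exists_frobenius_eq_mul`). If e has base-q digits e_i, then g^e
is the value at α of the product of the (h^i X + b)^{e_i}, a polynomial of degree at most the digit
sum of e, hence less than n (`exists_aeval_eq_pow`). Polynomials of degree less than n are
determined by their value at α.

The digits are recovered without knowing α or b. The trace from K to F sends f(α) with deg f < n to
n f(0), because the nonconstant powers of α have trace 0. Now g^e (g^{q-1} - 1) = g^{e-1} (g^q - g)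
= (h - 1) α g^{e-1}, so its trace vanishes exactly when α g^{e-1} is represented by a multiple of X,
that is, when g^{e-1} has a representative of degree at most n - 2. This happens exactly when the
lowest digit of e is nonzero (`frobeniusSum_eq_zero_iff`): if that digit is 0, such a representative
would make X + b a factor of the product above, whose roots -b h^{-i} with 0 < i < n all differ from
-b. Depending on the test, one divides by g or extracts a q-th root; `iterate_decodeStep` shows that
this recovers e. Uniqueness follows, since the procedure sees only g and g^e.

The procedure is deterministic. On the machine a field element is one integer, whose digits in a
large base B are the coefficients of its representative modulo u. Integer arithmetic then performs
polynomial arithmetic without carries, and `redProg` reduces modulo u and p. The running time is the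
number of steps times a bound on the cost of one step, both polynomial in log(q^n). -/

/-- `Exec M P s s' N`: the coin-free program `P` takes the data `s` to `s'` in `N` steps, and all
numbers handled on the way are less than `2 ^ M`. -/
inductive Exec (M : ℕ) : Prog → Store → Store → ℕ → Prop
  | skip (s : Store) : Exec M .skip s s 1
  | const (s : Store) (i c : ℕ) (h : c < 2 ^ M) : Exec M (.const i c) s (s.set i c) 1
  | copy (s : Store) (i j : ℕ) (h : s.reg j < 2 ^ M) :
      Exec M (.copy i j) s (s.set i (s.reg j)) 1
  | op (s : Store) (o : BinOp) (i j k : ℕ) (hj : s.reg j < 2 ^ M) (hk : s.reg k < 2 ^ M) :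
      Exec M (.op o i j k) s (s.set i (o.eval (s.reg j) (s.reg k))) 1
  | load (s : Store) (i j : ℕ) (hj : s.reg j < 2 ^ M) (hm : s.mem (s.reg j) < 2 ^ M) :
      Exec M (.load i j) s (s.set i (s.mem (s.reg j))) 1
  | seq {a b : Prog} {s s₁ s₂ : Store} {N₁ N₂ : ℕ} (h₁ : Exec M a s s₁ N₁)
      (h₂ : Exec M b s₁ s₂ N₂) : Exec M (.seq a b) s s₂ (N₁ + N₂ + 1)
  | ifNZ {i : ℕ} {a b : Prog} {s s' : Store} {N : ℕ} (hi : s.reg i < 2 ^ M)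
      (h : Exec M (if s.reg i ≠ 0 then a else b) s s' N) : Exec M (.ifNZ i a b) s s' (N + 1)
  | whileDone {i : ℕ} {a : Prog} {s : Store} (h : s.reg i = 0) : Exec M (.whileNZ i a) s s 1
  | whileStep {i : ℕ} {a : Prog} {s s₁ s₂ : Store} {N₁ N₂ : ℕ} (h0 : s.reg i ≠ 0)
      (hi : s.reg i < 2 ^ M) (h₁ : Exec M a s s₁ N₁) (h₂ : Exec M (.whileNZ i a) s₁ s₂ N₂) :
      Exec M (.whileNZ i a) s s₂ (N₁ + N₂ + 1)

theorem run_succ' (coins : ℕ → Bool) (c : Cfg) (t : ℕ) :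
    run coins c (t + 1) = run (fun k => coins (k + 1)) (step (coins 0) c) t := by
  induction t with
  | zero => rfl
  | succ t ih => rw [run, ih]; rfl

theorem run_add (coins : ℕ → Bool) (c : Cfg) (t r : ℕ) :
    run coins c (t + r) = run (fun k => coins (t + k)) (run coins c t) r := by
  induction r with
  | zero => rfl
  | succ r ih => rw [← add_assoc, run, ih]; rfl

theorem Exec.run_eq {M : ℕ} {P : Prog} {s s' : Store} {N : ℕ} (h : Exec M P s s' N) :
    ∀ (r : List Prog) (coins : ℕ → Bool), run coins ⟨P :: r, s⟩ N = ⟨r, s'⟩ := by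
  induction h with
  | skip | const | copy | op | load => intro r coins; rfl
  | seq _ _ ih₁ ih₂ =>
    intro r coins
    rw [run_succ', run_add]
    simp only [step, ih₁, ih₂]
  | ifNZ _ _ ih =>
    intro r coins
    rw [run_succ']
    simp only [step, ih]
  | whileDone h => intro r coins; simp [run, step, h]
  | whileStep h0 _ _ _ ih₁ ih₂ =>
    intro r coins
    rw [run_succ', run_add]
    simp only [step, if_pos h0, ih₁, ih₂]

theorem run_of_todo_nil (coins : ℕ → Bool) (s : Store) (t : ℕ) : run coins ⟨[], s⟩ t = ⟨[], s⟩ := by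
  induction t with
  | zero => rfl
  | succ t ih => rw [run, ih]; rfl

/-- The expected cost of the whole computation from a configuration. -/
noncomputable def expectedCost (c : Cfg) : ℝ≥0∞ := ⨆ t, expectedCostUpTo t c

/-- Both coin values lead to the same configuration, so the average over the coin is a single term.
-/
theorem expectedCost_le_of_step {c c' : Cfg} {k : ℕ} (hk : stepCost c ≤ k)
    (hc : ∀ b, step b c = c') : expectedCost c ≤ k + expectedCost c' := by
  refine iSup_le fun t => ?_
  cases t with
  | zero => simp [expectedCostUpTo]
  | succ t =>
    rw [expectedCostUpTo, hc, hc, ENNReal.add_div, ENNReal.add_halves]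
    gcongr
    exact le_iSup (fun t => expectedCostUpTo t c') t

theorem size_le_of_lt {a M : ℕ} (h : a < 2 ^ M) : a.size ≤ M := Nat.size_le.2 h

theorem BinOp.cost_le (o : BinOp) {a b M : ℕ} (ha : a < 2 ^ M) (hb : b < 2 ^ M) :
    o.cost a b ≤ (M + 1) ^ 2 := by
  have ha := size_le_of_lt ha
  have hb := size_le_of_lt hb
  have : (a.size + 1) * (b.size + 1) ≤ (M + 1) * (M + 1) := by gcongr
  cases o <;> simp only [BinOp.cost] <;> nlinarith

/-- Schoolbook multiplication and division of numbers of at most M bits cost at most (M + 1)^2;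
every other instruction is linear in M and obeys the same bound. -/
theorem Exec.expectedCost_le {M : ℕ} {P : Prog} {s s' : Store} {N : ℕ} (h : Exec M P s s' N) :
    ∀ r : List Prog,
      expectedCost ⟨P :: r, s⟩ ≤ ((N * (M + 1) ^ 2 : ℕ) : ℝ≥0∞) + expectedCost ⟨r, s'⟩ := by
  have one_le : 1 ≤ (M + 1) ^ 2 := Nat.one_le_pow _ _ (by omega)
  have le_sq : ∀ {a}, a < 2 ^ M → a.size + 1 ≤ (M + 1) ^ 2 := fun h => by
    nlinarith [size_le_of_lt h]
  have key : ∀ {c c₁ c₂ : Cfg} {N₁ : ℕ}, stepCost c ≤ (M + 1) ^ 2 → (∀ b, step b c = c₁) →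
      expectedCost c₁ ≤ ((N₁ * (M + 1) ^ 2 : ℕ) : ℝ≥0∞) + expectedCost c₂ →
      expectedCost c ≤ (((N₁ + 1) * (M + 1) ^ 2 : ℕ) : ℝ≥0∞) + expectedCost c₂ := by
    intro c c₁ c₂ N₁ h1 h2 h3
    refine (expectedCost_le_of_step h1 h2).trans ?_
    rw [add_mul, one_mul, Nat.cast_add, add_right_comm, add_comm]
    rw [add_comm]
    rw [add_comm (((N₁ * (M + 1) ^ 2 : ℕ) : ℝ≥0∞) + expectedCost c₂)]
    gcongr
  have base : ∀ {c c₂ : Cfg}, stepCost c ≤ (M + 1) ^ 2 → (∀ b, step b c = c₂) →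
      expectedCost c ≤ ((1 * (M + 1) ^ 2 : ℕ) : ℝ≥0∞) + expectedCost c₂ := fun h1 h2 =>
    key (N₁ := 0) h1 h2 (by simp)
  have trans : ∀ {c c₁ c₂ : Cfg} {N₁ N₂ : ℕ},
      expectedCost c ≤ ((N₁ * (M + 1) ^ 2 : ℕ) : ℝ≥0∞) + expectedCost c₁ →
      expectedCost c₁ ≤ ((N₂ * (M + 1) ^ 2 : ℕ) : ℝ≥0∞) + expectedCost c₂ →
      expectedCost c ≤ (((N₁ + N₂) * (M + 1) ^ 2 : ℕ) : ℝ≥0∞) + expectedCost c₂ := by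
    intro c c₁ c₂ N₁ N₂ h1 h2
    refine h1.trans ?_
    rw [add_mul, Nat.cast_add, add_assoc]
    gcongr
  induction h with
  | skip => exact fun r => base one_le fun _ => rfl
  | const s i c h => exact fun r => base (le_sq h) fun _ => rfl
  | copy s i j h => exact fun r => base (le_sq h) fun _ => rfl
  | op s o i j k hj hk => exact fun r => base (o.cost_le hj hk) fun _ => rfl
  | load s i j hj hm =>
    refine fun r => base ?_ fun _ => rfl
    have := size_le_of_lt hj
    have := size_le_of_lt hm
    simp only [stepCost]
    nlinarith
  | seq _ _ ih₁ ih₂ => exact fun r => key one_le (fun _ => rfl) (trans (ih₁ _) (ih₂ _))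
  | ifNZ hi _ ih => exact fun r => key (le_sq hi) (fun _ => rfl) (ih _)
  | whileDone h =>
    refine fun r => base ?_ fun _ => ?_
    · simpa [stepCost, h] using one_le
    · simp [step, h]
  | whileStep h0 hi _ _ ih₁ ih₂ =>
    refine fun r => key (le_sq hi) (fun _ => ?_) (trans (ih₁ _) (ih₂ _))
    simp only [step, if_pos h0]

/-- A halted configuration never changes. A halt at time t can therefore be compared at time t + N
with the halt after N steps that `Exec` provides, whatever the coins are. -/
theorem Exec.findsInExpectedTime {M : ℕ} {P : Prog} {input : List ℕ} {s' : Store} {N T : ℕ}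
    (h : Exec M P ⟨fun _ => 0, fun i => input.getD i 0⟩ s' N) (hT : N * (M + 1) ^ 2 ≤ T) :
    FindsInExpectedTime P input (s'.reg 0) T := by
  constructor
  · intro coins t ht
    have h1 : run coins (start P input) (t + N) = run coins (start P input) t := by
      rcases hc : run coins (start P input) t with ⟨todo, s⟩
      rw [hc] at ht
      obtain rfl : todo = [] := ht
      rw [run_add, hc, run_of_todo_nil]
    rw [← h1, add_comm, run_add, start, h.run_eq, run_of_todo_nil]
  · refine (h.expectedCost_le []).trans ?_
    have h0 : expectedCost ⟨[], s'⟩ = 0 := by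
      refine le_antisymm (iSup_le fun t => ?_) bot_le
      induction t with
      | zero => simp [expectedCostUpTo]
      | succ t ih =>
        simp only [expectedCostUpTo, step, stepCost]
        simp [le_antisymm ih bot_le]
    rw [h0, add_zero]
    exact_mod_cast hT

/-- From data `s` the program `P` ends, within the bound `2 ^ M` on all numbers, such that the
final data and the number of steps, counted from `n`, satisfy `Q`. -/
def Wp (M : ℕ) (P : Prog) (n : ℕ) (s : Store) (Q : Store → ℕ → Prop) : Prop :=
  ∃ s' N, Exec M P s s' N ∧ Q s' (n + N)

/-- Sequential composition of a list of programs. -/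
def block : List Prog → Prog
  | [] => .skip
  | P :: l => .seq P (block l)

/-- The data `s` and `s'` agree on the registers below `b` and on the memory. -/
def Agree (b : ℕ) (s s' : Store) : Prop := (∀ i < b, s.reg i = s'.reg i) ∧ s.mem = s'.mem

@[simp] theorem Store.set_reg (s : Store) (i x j : ℕ) :
    (s.set i x).reg j = if j = i then x else s.reg j := by
  simp [Store.set, Function.update_apply]

@[simp] theorem Store.set_mem (s : Store) (i x : ℕ) : (s.set i x).mem = s.mem := rfl

namespace Agree
variable {b b' : ℕ} {s s' s'' : Store}

theorem refl (b : ℕ) (s : Store) : Agree b s s := ⟨fun _ _ => rfl, rfl⟩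

theorem symm (h : Agree b s s') : Agree b s' s := ⟨fun i hi => (h.1 i hi).symm, h.2.symm⟩

theorem trans (h : Agree b s s') (h' : Agree b s' s'') : Agree b s s'' :=
  ⟨fun i hi => (h.1 i hi).trans (h'.1 i hi), h.2.trans h'.2⟩

theorem mono (h : Agree b s s') (hb : b' ≤ b) : Agree b' s s' :=
  ⟨fun i hi => h.1 i (hi.trans_le hb), h.2⟩

theorem set {j : ℕ} (h : Agree b s s') (hj : b ≤ j) (x : ℕ) : Agree b (s.set j x) s' :=
  ⟨fun i hi => by rw [Store.set_reg, if_neg (by omega), h.1 i hi], h.2⟩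

@[simp] theorem set_iff {j x : ℕ} (hj : b ≤ j) : Agree b (s.set j x) s' ↔ Agree b s s' := by
  refine ⟨fun h => ⟨fun i hi => ?_, h.2⟩, fun h => h.set hj x⟩
  rw [← h.1 i hi, Store.set_reg, if_neg (by omega)]

@[simp] theorem set_iff_right {j x : ℕ} (hj : b ≤ j) :
    Agree b s (s'.set j x) ↔ Agree b s s' :=
  ⟨fun h => ((set_iff hj).1 h.symm).symm, fun h => (h.symm.set hj x).symm⟩

end Agree

section Wp
variable {M n : ℕ} {s : Store} {Q : Store → ℕ → Prop}

@[simp] theorem wp_skip : Wp M .skip n s Q ↔ Q s (n + 1) :=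
  ⟨fun ⟨_, _, h, hQ⟩ => by cases h; exact hQ, fun hQ => ⟨_, _, .skip s, hQ⟩⟩

@[simp] theorem wp_const {i c : ℕ} :
    Wp M (.const i c) n s Q ↔ c < 2 ^ M ∧ Q (s.set i c) (n + 1) :=
  ⟨fun ⟨_, _, h, hQ⟩ => by cases h; exact ⟨‹_›, hQ⟩, fun h => ⟨_, _, .const s i c h.1, h.2⟩⟩

@[simp] theorem wp_copy {i j : ℕ} :
    Wp M (.copy i j) n s Q ↔ s.reg j < 2 ^ M ∧ Q (s.set i (s.reg j)) (n + 1) :=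
  ⟨fun ⟨_, _, h, hQ⟩ => by cases h; exact ⟨‹_›, hQ⟩, fun h => ⟨_, _, .copy s i j h.1, h.2⟩⟩

@[simp] theorem wp_op {o : BinOp} {i j k : ℕ} :
    Wp M (.op o i j k) n s Q ↔ s.reg j < 2 ^ M ∧ s.reg k < 2 ^ M ∧
      Q (s.set i (o.eval (s.reg j) (s.reg k))) (n + 1) :=
  ⟨fun ⟨_, _, h, hQ⟩ => by cases h; exact ⟨‹_›, ‹_›, hQ⟩,
    fun h => ⟨_, _, .op s o i j k h.1 h.2.1, h.2.2⟩⟩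

@[simp] theorem wp_load {i j : ℕ} :
    Wp M (.load i j) n s Q ↔ s.reg j < 2 ^ M ∧ s.mem (s.reg j) < 2 ^ M ∧
      Q (s.set i (s.mem (s.reg j))) (n + 1) :=
  ⟨fun ⟨_, _, h, hQ⟩ => by cases h; exact ⟨‹_›, ‹_›, hQ⟩,
    fun h => ⟨_, _, .load s i j h.1 h.2.1, h.2.2⟩⟩

@[simp] theorem wp_block_nil : Wp M (block []) n s Q ↔ Q s (n + 1) := wp_skip

@[simp] theorem wp_block_cons {P : Prog} {l : List Prog} :
    Wp M (block (P :: l)) n s Q ↔ Wp M P (n + 1) s fun s' n' => Wp M (block l) n' s' Q := by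
  constructor
  · rintro ⟨s', N, h, hQ⟩
    cases h with
    | seq h₁ h₂ =>
      refine ⟨_, _, h₁, _, _, h₂, ?_⟩
      convert hQ using 1
      omega
  · rintro ⟨s₁, N₁, h₁, s₂, N₂, h₂, hQ⟩
    refine ⟨s₂, _, h₁.seq h₂, ?_⟩
    convert hQ using 1
    omega

@[simp] theorem wp_ifNZ {i : ℕ} {a b : Prog} :
    Wp M (.ifNZ i a b) n s Q ↔ s.reg i < 2 ^ M ∧
      (s.reg i ≠ 0 → Wp M a (n + 1) s Q) ∧ (s.reg i = 0 → Wp M b (n + 1) s Q) := by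
  have h1 : Wp M (.ifNZ i a b) n s Q ↔
      s.reg i < 2 ^ M ∧ Wp M (if s.reg i ≠ 0 then a else b) (n + 1) s Q := by
    constructor
    · rintro ⟨s', N, h, hQ⟩
      cases h with
      | ifNZ hi h =>
        refine ⟨hi, _, _, h, ?_⟩
        convert hQ using 1
        omega
    · rintro ⟨hi, s', N, h, hQ⟩
      refine ⟨s', _, h.ifNZ hi, ?_⟩
      convert hQ using 1
      omega
  rw [h1]
  by_cases h : s.reg i = 0 <;> simp [h]

theorem Wp.mono {P : Prog} {Q' : Store → ℕ → Prop} (h : Wp M P n s Q)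
    (hQ : ∀ s' n', Q s' n' → Q' s' n') : Wp M P n s Q' := by
  obtain ⟨s', N, h, h'⟩ := h
  exact ⟨s', N, h, hQ _ _ h'⟩

/-- A loop with a variant `k` that decreases in each iteration; `T` bounds the number of steps of an
iteration. -/
theorem wp_while {i : ℕ} {a : Prog} (T : ℕ) (I : ℕ → Store → Prop) (k : ℕ) (hs : I k s)
    (hlt : ∀ k s, I k s → s.reg i < 2 ^ M) (h0 : ∀ s, I 0 s → s.reg i = 0)
    (hstep : ∀ k s, I (k + 1) s → s.reg i ≠ 0 →
      ∀ n, Wp M a n s fun s' n' => I k s' ∧ n' ≤ n + T)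
    (hQ : ∀ s' n' k', I k' s' → s'.reg i = 0 → n' ≤ n + (k * (T + 1) + 1) → Q s' n') :
    Wp M (.whileNZ i a) n s Q := by
  suffices h : ∃ s' N k', Exec M (.whileNZ i a) s s' N ∧ I k' s' ∧ s'.reg i = 0 ∧
      N ≤ k * (T + 1) + 1 by
    obtain ⟨s', N, k', h, h1, h2, h3⟩ := h
    exact ⟨s', N, h, hQ _ _ _ h1 h2 (by omega)⟩
  clear hQ
  induction k generalizing s with
  | zero => exact ⟨s, 1, 0, .whileDone (h0 s hs), hs, h0 s hs, by omega⟩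
  | succ k ih =>
    by_cases hi : s.reg i = 0
    · exact ⟨s, 1, _, .whileDone hi, hs, hi, by omega⟩
    obtain ⟨s₁, N₁, h4, h5, h6⟩ := hstep k s hs hi 0
    obtain ⟨s₂, N₂, k', h7, h8, h9, h10⟩ := ih h5
    refine ⟨s₂, _, k', .whileStep hi (hlt _ _ hs) h4 h7, h8, h9, ?_⟩
    rw [add_mul]
    omega

end Wp
end RAM

/-! ### Digit sums and the decoding procedure. -/

theorem digitSum_eq_mod_add {q : ℕ} (hq : 2 ≤ q) (e : ℕ) :
    digitSum q e = e % q + digitSum q (e / q) := by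
  rcases Nat.eq_zero_or_pos e with rfl | he
  · simp [digitSum]
  · rw [digitSum, Nat.digits_def' hq he, List.sum_cons, digitSum]

theorem digitSum_zero (q : ℕ) : digitSum q 0 = 0 := by simp [digitSum]

/-- With a nonzero lowest digit the subtraction needs no borrow. -/
theorem digitSum_sub_one {q : ℕ} (hq : 2 ≤ q) {e : ℕ} (he : e % q ≠ 0) :
    digitSum q (e - 1) + 1 = digitSum q e := by
  have h1 : (e - 1) % q = e % q - 1 ∧ (e - 1) / q = e / q := by
    have h2 : e - 1 = (e % q - 1) + q * (e / q) := by
      have := Nat.mod_add_div e q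
      omega
    have h3 : e % q - 1 < q := (Nat.sub_le _ _).trans_lt (Nat.mod_lt _ (by omega))
    rw [h2, Nat.add_mul_mod_self_left, Nat.mod_eq_of_lt h3, Nat.add_mul_div_left _ _ (by omega),
      Nat.div_eq_of_lt h3, zero_add]
    exact ⟨rfl, rfl⟩
  rw [digitSum_eq_mod_add hq e, digitSum_eq_mod_add hq (e - 1), h1.1, h1.2]
  omega

theorem eq_zero_of_digitSum_eq_zero {q : ℕ} (hq : 2 ≤ q) {e : ℕ} (h : digitSum q e = 0) :
    e = 0 := by
  induction e using Nat.strong_induction_on with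
  | _ e ih =>
    by_contra he
    rw [digitSum_eq_mod_add hq] at h
    have h1 := ih (e / q) (Nat.div_lt_self (by omega) (by omega)) (by omega)
    have := Nat.mod_add_div e q
    rw [h1] at this
    omega

/-- The sum of the first `n` iterates of the `q`-power map at `x`; for an extension of degree `n` of
a field with `q` elements this is the trace of `x`. -/
def frobeniusSum {K : Type*} [Semiring K] (q n : ℕ) (x : K) : K :=
  ∑ k ∈ Finset.range n, x ^ q ^ k

open Classical in
/-- One step of the decoding of an exponent: `(w, Q, e)` consists of the power `w` whose exponent is
still to be found, the weight `Q` of its lowest digit, and the part `e` found so far. -/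
noncomputable def decodeStep {K : Type*} [CommRing K] (q n : ℕ) (g : K) (x : K × ℕ × ℕ) :
    K × ℕ × ℕ :=
  if frobeniusSum q n (x.1 * (g ^ (q - 1) - 1)) = 0 then
    (x.1 * g ^ (q ^ n - 2), x.2.1, x.2.2 + x.2.1)
  else (x.1 ^ q ^ (n - 1), x.2.1 * q, x.2.2)

/-! ### Frobenius and trace on a Kummer extension; correctness of the decoding. -/

section Kummer

variable {F K : Type*} [Field F] [Finite F] [Field K] [Algebra F K]

theorem pow_natCard_of_finite (x : F) : x ^ Nat.card F = x := by
  have := Fintype.ofFinite F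
  rw [Nat.card_eq_fintype_card, FiniteField.pow_card]

theorem add_pow_natCard_pow (x y : K) (k : ℕ) :
    (x + y) ^ Nat.card F ^ k = x ^ Nat.card F ^ k + y ^ Nat.card F ^ k := by
  have := Fintype.ofFinite F
  obtain ⟨p, hp⟩ := CharP.exists F
  have : CharP K p := charP_of_injective_algebraMap (algebraMap F K).injective p
  obtain ⟨m, hpp, hm⟩ := FiniteField.card F p
  have : ExpChar K p := ExpChar.prime hpp
  rw [Nat.card_eq_fintype_card, hm, ← pow_mul, add_pow_expChar_pow]

theorem algebraMap_pow_natCard_pow (x : F) (k : ℕ) :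
    algebraMap F K x ^ Nat.card F ^ k = algebraMap F K x := by
  induction k with
  | zero => simp
  | succ k ih => rw [pow_succ, pow_mul, ih, ← map_pow, pow_natCard_of_finite]

theorem frobeniusSum_add (n : ℕ) (x y : K) :
    frobeniusSum (Nat.card F) n (x + y) =
      frobeniusSum (Nat.card F) n x + frobeniusSum (Nat.card F) n y := by
  simp [frobeniusSum, add_pow_natCard_pow, Finset.sum_add_distrib]

theorem frobeniusSum_algebraMap_mul (n : ℕ) (c : F) (x : K) :
    frobeniusSum (Nat.card F) n (algebraMap F K c * x) =
      algebraMap F K c * frobeniusSum (Nat.card F) n x := by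
  simp [frobeniusSum, mul_pow, algebraMap_pow_natCard_pow, Finset.mul_sum]

/-- The minimal polynomial of a generator has degree [K : F]. This turns equations in K into
polynomial identities. -/
theorem aeval_injOn_natDegree_lt {α : K} [FiniteDimensional F K] (hα : F⟮α⟯ = ⊤) {f g : F[X]}
    (hf : f.natDegree < Module.finrank F K) (hg : g.natDegree < Module.finrank F K)
    (h : aeval α f = aeval α g) : f = g := by
  have hint : IsIntegral F α := .of_finite F α
  have hd : (minpoly F α).natDegree = Module.finrank F K := by
    rw [← IntermediateField.adjoin.finrank hint, hα, IntermediateField.finrank_top']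
  rw [← sub_eq_zero]
  refine eq_zero_of_dvd_of_natDegree_lt (minpoly.dvd F α (p := f - g) ?_)
    ((natDegree_sub_le f g).trans_lt (by rw [hd]; exact max_lt hf hg))
  rw [map_sub, h, sub_self]

theorem aeval_pow_natCard (α : K) (f : F[X]) :
    aeval α f ^ Nat.card F = aeval (α ^ Nat.card F) f := by
  induction f using Polynomial.induction_on' with
  | add f g hf hg =>
    have := add_pow_natCard_pow (F := F) (aeval α f) (aeval α g) 1
    rw [pow_one] at this
    rw [map_add, map_add, this, hf, hg]
  | monomial k a =>
    have := algebraMap_pow_natCard_pow (K := K) a 1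
    rw [pow_one] at this
    rw [aeval_monomial, aeval_monomial, mul_pow, this, ← pow_mul, ← pow_mul, mul_comm k]

variable {n : ℕ} {α : K}

theorem ne_zero_of_adjoin_eq_top (hn : Module.finrank F K = n) (h2 : 2 ≤ n) (hα : F⟮α⟯ = ⊤) :
    α ≠ 0 := by
  rintro rfl
  rw [IntermediateField.adjoin_zero] at hα
  have := IntermediateField.finrank_bot (F := F) (E := K)
  rw [hα, IntermediateField.finrank_top'] at this
  omega

theorem adjoin_singleton_eq_top [FiniteDimensional F K] (hα : F⟮α⟯ = ⊤) :
    Algebra.adjoin F {α} = ⊤ := by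
  rw [← IntermediateField.adjoin_simple_toSubalgebra_of_isAlgebraic (Algebra.IsAlgebraic.isAlgebraic α), hα,
    IntermediateField.top_toSubalgebra]

/-- If n were 0 in F, then q = 1 + nk would be 1 in F, although q is 0 there. The constant
coefficient can thus be read off from n times it. -/
theorem natCast_ne_zero_of_dvd_natCard_sub_one (hdvd : n ∣ Nat.card F - 1) : (n : F) ≠ 0 := by
  intro h0
  obtain ⟨k, hk⟩ := hdvd
  have h1 : ((Nat.card F : ℕ) : F) = 0 := by
    have := Fintype.ofFinite F
    rw [Nat.card_eq_fintype_card, FiniteField.cast_card_eq_zero]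
  have h2 := Nat.sub_add_cancel (Finite.one_lt_card (α := F)).le
  rw [hk] at h2
  rw [← h2] at h1
  simp [h0] at h1

/-- The Frobenius map multiplies a Kummer generator by a primitive root of unity. -/
theorem exists_frobenius_eq_mul (hn : Module.finrank F K = n) (h2 : 2 ≤ n)
    (hdvd : n ∣ Nat.card F - 1) (hα : F⟮α⟯ = ⊤) (hαn : α ^ n ∈ (algebraMap F K).range) :
    ∃ h : F, α ^ Nat.card F = algebraMap F K h * α ∧ h ^ n = 1 ∧
      ∀ j, 0 < j → j < n → h ^ j ≠ 1 := by
  have := Fintype.ofFinite F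
  have hfin : FiniteDimensional F K := FiniteDimensional.of_finrank_pos (by omega)
  have : Finite K := Module.finite_of_finite F
  have hα0 := ne_zero_of_adjoin_eq_top hn h2 hα
  obtain ⟨a, ha⟩ := hαn
  obtain ⟨k, hk⟩ := hdvd
  have hq : 1 < Nat.card F := Finite.one_lt_card
  -- Here q - 1 = nk, so α^(q-1) = (α^n)^k = a^k.
  have hfr : α ^ Nat.card F = algebraMap F K (a ^ k) * α := by
    rw [map_pow, ha, ← pow_mul, ← hk, ← pow_succ, Nat.sub_add_cancel hq.le]
  refine ⟨a ^ k, hfr, ?_, ?_⟩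
  · have ha0 : a ≠ 0 := by
      rintro rfl
      rw [map_zero] at ha
      exact hα0 (pow_eq_zero_iff (by omega) |>.1 ha.symm)
    rw [← pow_mul, mul_comm, ← hk, Nat.card_eq_fintype_card]
    exact FiniteField.pow_card_sub_one_eq_one a ha0
  · intro j hj hjn hj1
    -- If h^j = 1, the j-th iterate of Frobenius fixes the generator α and so all of K; but
    -- Frobenius has order n.
    have hiter : ∀ i, ((FiniteField.frobeniusAlgHom F K) ^ i) α
        = algebraMap F K ((a ^ k) ^ i) * α := by
      intro i
      induction i with
      | zero => simp
      | succ i ih =>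
        rw [pow_succ', AlgHom.mul_apply, ih, map_mul, AlgHom.commutes]
        rw [FiniteField.coe_frobeniusAlgHom]
        simp only [← Nat.card_eq_fintype_card, hfr]
        rw [← mul_assoc, ← map_mul, pow_succ]
    have h1 : (FiniteField.frobeniusAlgHom F K) ^ j = 1 := by
      refine AlgHom.ext_of_adjoin_eq_top (adjoin_singleton_eq_top hα) ?_
      rintro x rfl
      rw [hiter, hj1, map_one, one_mul, AlgHom.one_apply]
    have := orderOf_dvd_of_pow_eq_one h1
    rw [FiniteField.orderOf_frobeniusAlgHom, hn] at this
    exact absurd (Nat.le_of_dvd hj this) (by omega)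

/-- A generator `α` of a finite extension of degree `n`, which the Frobenius map multiplies by a
primitive `n`-th root of unity `h`. -/
structure FrobeniusEigen (n : ℕ) (α : K) (h : F) : Prop where
  finrank_eq : Module.finrank F K = n
  two_le : 2 ≤ n
  adjoin_eq : F⟮α⟯ = ⊤
  frobenius_eq : α ^ Nat.card F = algebraMap F K h * α
  pow_eq_one : h ^ n = 1
  pow_ne_one : ∀ j, 0 < j → j < n → h ^ j ≠ 1

namespace FrobeniusEigen
variable {h : F}

theorem finiteDimensional (H : FrobeniusEigen n α h) : FiniteDimensional F K :=
  FiniteDimensional.of_finrank_pos (by have := H.two_le; have := H.finrank_eq; omega)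

theorem ne_zero (H : FrobeniusEigen n α h) : α ≠ 0 :=
  ne_zero_of_adjoin_eq_top H.finrank_eq H.two_le H.adjoin_eq

theorem natDegree_minpoly (H : FrobeniusEigen n α h) : (minpoly F α).natDegree = n := by
  have := H.finiteDimensional
  rw [← IntermediateField.adjoin.finrank (.of_finite F α), H.adjoin_eq,
    IntermediateField.finrank_top', H.finrank_eq]

theorem exists_aeval_eq (H : FrobeniusEigen n α h) (x : K) :
    ∃ f : F[X], f.natDegree < n ∧ aeval α f = x := by
  have := H.finiteDimensional
  have hx : x ∈ Algebra.adjoin F {α} := by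
    rw [adjoin_singleton_eq_top H.adjoin_eq]; trivial
  rw [Algebra.adjoin_singleton_eq_range_aeval] at hx
  obtain ⟨f, rfl⟩ := hx
  have hm := minpoly.monic (IsIntegral.of_finite F α)
  have h2 := H.two_le
  refine ⟨f %ₘ minpoly F α, ?_, ?_⟩
  · refine (natDegree_modByMonic_lt f hm ?_).trans_eq H.natDegree_minpoly
    intro h1
    have := H.natDegree_minpoly
    rw [h1, natDegree_one] at this
    omega
  · exact aeval_modByMonic_eq_self_of_root (minpoly.aeval F α)

theorem pow_natCard_pow (H : FrobeniusEigen n α h) (k : ℕ) :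
    α ^ Nat.card F ^ k = algebraMap F K (h ^ k) * α := by
  induction k with
  | zero => simp
  | succ k ih =>
    rw [pow_succ' (Nat.card F), pow_mul, H.frobenius_eq, mul_pow, ih, algebraMap_pow_natCard_pow,
      pow_succ', map_mul, mul_assoc]

/-- The conjugates of α^j are h^(jk) α^j, and the geometric sum of the powers of h^j ≠ 1 vanishes.
-/
theorem frobeniusSum_pow (H : FrobeniusEigen n α h) {j : ℕ} (hj : 0 < j) (hjn : j < n) :
    frobeniusSum (Nat.card F) n (α ^ j) = 0 := by
  have h1 : ∑ k ∈ Finset.range n, (h ^ j) ^ k = 0 := by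
    have h2 := geom_sum_mul (h ^ j) n
    rw [← pow_mul, mul_comm j, pow_mul, H.pow_eq_one, one_pow, sub_self] at h2
    exact (mul_eq_zero.1 h2).resolve_right (sub_ne_zero.2 (H.pow_ne_one j hj hjn))
  have h3 : frobeniusSum (Nat.card F) n (α ^ j) =
      algebraMap F K (∑ k ∈ Finset.range n, (h ^ j) ^ k) * α ^ j := by
    rw [frobeniusSum, map_sum, Finset.sum_mul]
    refine Finset.sum_congr rfl fun k _ => ?_
    rw [← pow_mul, mul_comm j, pow_mul, H.pow_natCard_pow, mul_pow, ← map_pow, ← pow_mul,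
      ← pow_mul, mul_comm k]
  rw [h3, h1, map_zero, zero_mul]

theorem frobeniusSum_aeval (H : FrobeniusEigen n α h) {f : F[X]} (hf : f.natDegree < n) :
    frobeniusSum (Nat.card F) n (aeval α f) = n * algebraMap F K (f.coeff 0) := by
  rw [aeval_eq_sum_range' hf]
  have h1 := map_sum (AddMonoidHom.mk' (frobeniusSum (K := K) (Nat.card F) n) (frobeniusSum_add n))
    (fun i => f.coeff i • α ^ i) (Finset.range n)
  simp only [AddMonoidHom.mk'_apply] at h1
  rw [h1, Finset.sum_eq_single 0]
  · rw [pow_zero, Algebra.smul_def, frobeniusSum_algebraMap_mul, frobeniusSum]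
    simp [mul_comm]
  · intro j hj hj0
    rw [Algebra.smul_def, frobeniusSum_algebraMap_mul,
      H.frobeniusSum_pow (Nat.pos_of_ne_zero hj0) (Finset.mem_range.1 hj), mul_zero]
  · intro h0
    have := H.two_le
    exact absurd (Finset.mem_range.2 (by omega)) h0

theorem aeval_comp (H : FrobeniusEigen n α h) (f : F[X]) :
    aeval α (f.comp (C h * X)) = aeval α f ^ Nat.card F := by
  rw [aeval_pow_natCard, H.frobenius_eq, Polynomial.aeval_comp]
  simp

theorem natDegree_comp_le (f : F[X]) (h : F) : (f.comp (C h * X)).natDegree ≤ f.natDegree := by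
  refine Polynomial.natDegree_comp_le.trans ?_
  exact (Nat.mul_le_mul_left _ ((natDegree_C_mul_le h X).trans natDegree_X_le)).trans (by rw [mul_one])

/-- The powers of `α + b` as values of products of linear polynomials. -/
theorem exists_aeval_eq_pow (H : FrobeniusEigen n α h) (b : F) (e : ℕ) :
    ∃ f : F[X], f.natDegree ≤ digitSum (Nat.card F) e ∧
      aeval α f = (α + algebraMap F K b) ^ e ∧
      ∀ k, e < Nat.card F ^ k → ∀ x, f.eval x = 0 → ∃ i < k, h ^ i * x = -b := by
  have hq : 2 ≤ Nat.card F := Finite.one_lt_card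
  induction e using Nat.strong_induction_on with
  | _ e ih =>
    rcases Nat.eq_zero_or_pos e with rfl | he
    · exact ⟨1, by simp, by simp, fun k _ x hx => by simp at hx⟩
    obtain ⟨f, hf1, hf2, hf3⟩ := ih (e / Nat.card F) (Nat.div_lt_self he hq)
    -- For e = e₀ + q e', raising f(α) = g^e' to the power q gives f(hα), because the coefficients
    -- of f lie in F. The lowest digit contributes the factor (X + b)^e₀.
    refine ⟨(X + C b) ^ (e % Nat.card F) * f.comp (C h * X), ?_, ?_, ?_⟩
    · rw [digitSum_eq_mod_add hq]
      refine natDegree_mul_le.trans (add_le_add ?_ ((natDegree_comp_le f h).trans hf1))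
      rw [natDegree_pow, natDegree_X_add_C, mul_one]
    · rw [map_mul, H.aeval_comp, hf2, map_pow, map_add, aeval_X, aeval_C, ← pow_mul, ← pow_add,
        mul_comm (e / _), Nat.mod_add_div]
    · intro k hk x hx
      obtain ⟨k, rfl⟩ : ∃ l, k = l + 1 :=
        Nat.exists_eq_succ_of_ne_zero (by rintro rfl; rw [pow_zero] at hk; omega)
      rw [eval_mul, eval_pow, eval_comp, eval_add, eval_X, eval_C, eval_mul, eval_C, eval_X,
        mul_eq_zero] at hx
      rcases hx with hx | hx
      · exact ⟨0, by omega, by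
          rw [pow_zero, one_mul]; exact eq_neg_of_add_eq_zero_left (by by_contra h0; exact pow_ne_zero _ h0 hx)⟩
      · obtain ⟨i, hi, hix⟩ := hf3 k (Nat.div_lt_of_lt_mul (by rwa [pow_succ'] at hk)) _ hx
        exact ⟨i + 1, by omega, by rw [pow_succ, mul_assoc, hix]⟩

theorem add_ne_zero (H : FrobeniusEigen n α h) (b : F) : α + algebraMap F K b ≠ 0 := by
  intro h0
  have := H.finiteDimensional
  have h2 := H.two_le
  have h1 := aeval_injOn_natDegree_lt H.adjoin_eq (f := X + C b) (g := 0)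
    (by rw [natDegree_X_add_C, H.finrank_eq]; omega)
    (by rw [natDegree_zero, H.finrank_eq]; omega) (by simpa using h0)
  exact (monic_X_add_C b).ne_zero h1

/-- Since b is fixed by Frobenius, it cancels in g^q - g = (h - 1)α. The left side is computable
from g alone, and the right side exposes the factor α. -/
theorem frobeniusSum_mul (H : FrobeniusEigen n α h) (b : F) (y : K) :
    frobeniusSum (Nat.card F) n ((α + algebraMap F K b) * y *
      ((α + algebraMap F K b) ^ (Nat.card F - 1) - 1)) =
      algebraMap F K (h - 1) * frobeniusSum (Nat.card F) n (α * y) := by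
  rw [← frobeniusSum_algebraMap_mul]
  congr 1
  have h1 := add_pow_natCard_pow (F := F) α (algebraMap F K b) 1
  rw [algebraMap_pow_natCard_pow, pow_one, H.frobenius_eq] at h1
  have h2 : (α + algebraMap F K b) * (α + algebraMap F K b) ^ (Nat.card F - 1) =
      (α + algebraMap F K b) ^ Nat.card F := by
    rw [← pow_succ', Nat.sub_add_cancel Finite.one_lt_card.le]
  calc _ = y * ((α + algebraMap F K b) * (α + algebraMap F K b) ^ (Nat.card F - 1) -
        (α + algebraMap F K b)) := by ring
    _ = _ := by rw [h2, h1, map_sub, map_one]; ring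

/-- The test for a nonzero lowest digit of the exponent. -/
theorem frobeniusSum_eq_zero_iff (H : FrobeniusEigen n α h) (hdvd : n ∣ Nat.card F - 1) {b : F}
    (hb : b ≠ 0) {e : ℕ} (he : e < Nat.card F ^ n) (hs : digitSum (Nat.card F) e < n) :
    frobeniusSum (Nat.card F) n ((α + algebraMap F K b) ^ e *
      ((α + algebraMap F K b) ^ (Nat.card F - 1) - 1)) = 0 ↔ e % Nat.card F ≠ 0 := by
  have hq : 2 ≤ Nat.card F := Finite.one_lt_card
  have hg := H.add_ne_zero b
  have h2 := H.two_le
  have hfin := H.finiteDimensional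
  constructor
  · intro h0 he0
    set g := α + algebraMap F K b with hgdef
    obtain ⟨P, hP, hPe⟩ := H.exists_aeval_eq (α * (g ^ e / g))
    have h3 := H.frobeniusSum_mul b (g ^ e / g)
    rw [← hgdef, mul_div_cancel₀ _ hg, h0, ← hPe, H.frobeniusSum_aeval hP] at h3
    have hh : h - 1 ≠ 0 := sub_ne_zero.2 (by simpa using H.pow_ne_one 1 one_pos (by omega))
    -- Neither h - 1 nor n vanishes in F, so a zero trace forces the constant coefficient to be
    -- zero.
    have hP0 : P.coeff 0 = 0 := by
      have h4 : algebraMap F K ((h - 1) * (n * P.coeff 0)) = 0 := by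
        rw [map_mul, map_mul, map_natCast, ← h3]
      have h5 := (map_eq_zero _).1 h4
      simpa [hh, natCast_ne_zero_of_dvd_natCard_sub_one hdvd] using h5
    obtain ⟨P₁, rfl⟩ := X_dvd_iff.2 hP0
    obtain ⟨f, hf1, hf2, hf3⟩ := H.exists_aeval_eq_pow b (e / Nat.card F)
    rw [map_mul, aeval_X] at hPe
    have h6 : aeval α P₁ = g ^ e / g := mul_left_cancel₀ H.ne_zero hPe
    -- Both sides have degree less than n and the value g^e at α: the left one because q divides e,
    -- the right one because `P₁` represents g^(e-1).
    have h7 : f.comp (C h * X) = P₁ * (X + C b) := by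
      refine aeval_injOn_natDegree_lt H.adjoin_eq ?_ ?_ ?_
      · rw [H.finrank_eq]
        refine ((natDegree_comp_le f h).trans hf1).trans_lt (lt_of_le_of_lt ?_ hs)
        rw [digitSum_eq_mod_add hq e]
        omega
      · rw [H.finrank_eq]
        rcases eq_or_ne P₁ 0 with rfl | hP₁
        · simp; omega
        · rw [natDegree_X_mul hP₁] at hP
          refine natDegree_mul_le.trans_lt ?_
          rwa [natDegree_X_add_C]
      · rw [H.aeval_comp, hf2, map_mul, h6, map_add, aeval_X, aeval_C, ← hgdef, ← pow_mul,
          div_mul_cancel₀ _ hg, Nat.div_mul_cancel (Nat.dvd_of_mod_eq_zero he0)]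
    have h8 := congrArg (eval (-b)) h7
    rw [eval_comp, eval_mul, eval_mul, eval_add, eval_C, eval_X, eval_C, neg_add_cancel,
      mul_zero] at h8
    -- As e / q has at most n - 1 digits, 0 < i + 1 < n, and h^(i+1) = 1 contradicts primitivity.
    obtain ⟨i, hi, hib⟩ := hf3 (n - 1) (Nat.div_lt_of_lt_mul (by
      rwa [← pow_succ', Nat.sub_add_cancel (by omega)])) _ h8
    refine H.pow_ne_one (i + 1) (by omega) (by omega) ?_
    rw [← mul_assoc, ← pow_succ] at hib
    simpa [hb] using hib
  · intro he0
    obtain ⟨e, rfl⟩ : ∃ l, e = l + 1 :=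
      Nat.exists_eq_succ_of_ne_zero (by rintro rfl; simp at he0)
    have h3 := digitSum_sub_one hq he0
    rw [Nat.add_sub_cancel] at h3
    -- Lowering the digit sum by one gives deg f ≤ n - 2, so X f still has degree less than n, and
    -- its constant term is 0.
    obtain ⟨f, hf1, hf2, hf3⟩ := H.exists_aeval_eq_pow b e
    rw [pow_succ', H.frobeniusSum_mul, ← hf2]
    have h4 : α * aeval α f = aeval α (X * f) := by simp
    rw [h4, H.frobeniusSum_aeval]
    · simp
    · refine natDegree_mul_le.trans_lt ?_
      rw [natDegree_X]
      omega

/-- The number l bounds the digits that remain. A division by g lowers the digit sum, a root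
extraction lowers l, so their sum bounds the steps needed; once e = 0, further steps change only the
weight. -/
theorem iterate_decodeStep (H : FrobeniusEigen n α h) (hdvd : n ∣ Nat.card F - 1) {b : F}
    (hb : b ≠ 0) : ∀ (t l e Q a : ℕ), e < Nat.card F ^ l → l ≤ n → digitSum (Nat.card F) e < n →
      digitSum (Nat.card F) e + l ≤ t →
      ((decodeStep (Nat.card F) n (α + algebraMap F K b))^[t]
        ((α + algebraMap F K b) ^ e, Q, a)).2.2 = a + Q * e := by
  have hq : 2 ≤ Nat.card F := Finite.one_lt_card
  have hg := H.add_ne_zero b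
  have hfin := H.finiteDimensional
  have : Finite K := Module.finite_of_finite F
  have hK : Nat.card K = Nat.card F ^ n := by rw [Module.natCard_eq_pow_finrank (K := F), H.finrank_eq]
  have h2 := H.two_le
  have hqn : 2 ≤ Nat.card F ^ n := hq.trans (Nat.le_self_pow (by omega) _)
  have hpowK : ∀ x : K, x ^ Nat.card F ^ n = x := fun x => by
    rw [← hK, pow_natCard_of_finite]
  intro t
  induction t with
  | zero =>
    intro l e Q a he hl hs ht
    obtain rfl : l = 0 := by omega
    obtain rfl : e = 0 := by simpa using he
    simp
  | succ t ih =>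
    intro l e Q a he hl hs ht
    rw [Function.iterate_succ_apply]
    have htest := H.frobeniusSum_eq_zero_iff hdvd hb (he.trans_le (Nat.pow_le_pow_right (by omega) hl)) hs
    by_cases h0 : e % Nat.card F = 0
    · rw [decodeStep, if_neg (fun hz => htest.1 hz h0)]
      have h4 : ((α + algebraMap F K b) ^ e) ^ Nat.card F ^ (n - 1) =
          (α + algebraMap F K b) ^ (e / Nat.card F) := by
        conv_lhs => rw [← Nat.div_mul_cancel (Nat.dvd_of_mod_eq_zero h0)]
        rw [pow_mul, ← pow_mul _ (Nat.card F), ← pow_succ', Nat.sub_add_cancel (by omega), hpowK]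
      have hds := digitSum_eq_mod_add hq e
      have hlt : e / Nat.card F < Nat.card F ^ (l - 1) := by
        rcases l with _ | l
        · obtain rfl : e = 0 := by simpa using he
          simp
        · exact Nat.div_lt_of_lt_mul (by rwa [pow_succ'] at he)
      simp only [h4]
      rcases Nat.eq_zero_or_pos l with rfl | hl0
      · obtain rfl : e = 0 := by simpa using he
        have := ih 0 0 (Q * Nat.card F) a (by simp) (by omega) (by rw [digitSum_zero]; omega)
          (by rw [digitSum_zero]; omega)
        simpa using this
      · rw [ih (l - 1) (e / Nat.card F) (Q * Nat.card F) a hlt (by omega) (by omega) (by omega),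
          mul_assoc, Nat.mul_div_cancel' (Nat.dvd_of_mod_eq_zero h0)]
    · rw [decodeStep, if_pos (htest.2 h0)]
      have hds := digitSum_sub_one hq h0
      have he1 : e = (e - 1) + 1 := by
        have : e ≠ 0 := by rintro rfl; simp at h0
        omega
      have h4 : (α + algebraMap F K b) ^ e * (α + algebraMap F K b) ^ (Nat.card F ^ n - 2) =
          (α + algebraMap F K b) ^ (e - 1) := by
        have h5 : (α + algebraMap F K b) * (α + algebraMap F K b) ^ (Nat.card F ^ n - 2) = 1 := by
          rw [← pow_succ', show Nat.card F ^ n - 2 + 1 = Nat.card F ^ n - 1 by omega]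
          refine mul_left_cancel₀ hg ?_
          rw [← pow_succ', Nat.sub_add_cancel (by omega), hpowK, mul_one]
        conv_lhs => rw [he1, pow_succ, mul_assoc, h5, mul_one]
      simp only [h4]
      rw [ih l (e - 1) Q (a + Q) (by omega) hl (by omega) (by omega)]
      conv_rhs => rw [he1]
      ring

end FrobeniusEigen

/-- The decoding finds every exponent whose digit sum is less than `n`. -/
theorem decode_eq {g : K} {e : ℕ} (hn : Module.finrank F K = n) (hdvd : n ∣ Nat.card F - 1)
    (hg : IsKummerShift F n g) (he : e < Nat.card F ^ n) (hs : digitSum (Nat.card F) e < n) :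
    ((decodeStep (Nat.card F) n g)^[3 * (n - 1)] (g ^ e, 1, 0)).2.2 = e := by
  obtain ⟨α, b, hα, hαn, hb, rfl⟩ := hg
  have hq : 2 ≤ Nat.card F := Finite.one_lt_card
  -- The decoding needs at most (n - 1) + n steps, which is at most 3(n - 1) only for n ≥ 2. For n =
  -- 1 the exponent is 0 and no step is made.
  rcases lt_or_ge n 2 with h2 | h2
  · obtain rfl : n = 1 := by omega
    obtain rfl := eq_zero_of_digitSum_eq_zero hq (Nat.lt_one_iff.1 hs)
    simp
  · obtain ⟨h, h1, h3, h4⟩ := exists_frobenius_eq_mul hn h2 hdvd hα hαn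
    have H : FrobeniusEigen n α h := ⟨hn, h2, hα, h1, h3, h4⟩
    rw [H.iterate_decodeStep hdvd hb _ n e 1 0 he le_rfl hs (by omega), zero_add, one_mul]

theorem eq_of_pow_eq_pow {g : K} {e e' : ℕ} (hn : Module.finrank F K = n)
    (hdvd : n ∣ Nat.card F - 1) (hg : IsKummerShift F n g) (he : e < Nat.card F ^ n)
    (hs : digitSum (Nat.card F) e < n) (he' : e' < Nat.card F ^ n)
    (hs' : digitSum (Nat.card F) e' < n) (h : g ^ e' = g ^ e) : e' = e := by
  rw [← decode_eq hn hdvd hg he hs, ← h, decode_eq hn hdvd hg he' hs']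

end Kummer

/-! ### Kronecker substitution: polynomials packed as integers in base B. -/

/-- The polynomial `f` has at most `i` coefficients, and these are at most `c`. -/
def CoeffBound (f : ℕ[X]) (i c : ℕ) : Prop :=
  (∀ j, i ≤ j → f.coeff j = 0) ∧ ∀ j, f.coeff j ≤ c

namespace CoeffBound
variable {f g : ℕ[X]} {i k c c' B : ℕ}

theorem mono (h : CoeffBound f i c) (hi : i ≤ k) (hc : c ≤ c') : CoeffBound f k c' :=
  ⟨fun j hj => h.1 j (hi.trans hj), fun j => (h.2 j).trans hc⟩

theorem zero : CoeffBound 0 i c := by simp [CoeffBound]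

theorem add (hf : CoeffBound f i c) (hg : CoeffBound g i c') : CoeffBound (f + g) i (c + c') := by
  refine ⟨fun j hj => ?_, fun j => ?_⟩
  · rw [coeff_add, hf.1 j hj, hg.1 j hj]
  · rw [coeff_add]
    exact add_le_add (hf.2 j) (hg.2 j)

theorem C_mul (hf : CoeffBound f i c) (t : ℕ) : CoeffBound (C t * f) i (t * c) := by
  refine ⟨fun j hj => ?_, fun j => ?_⟩
  · rw [coeff_C_mul, hf.1 j hj, mul_zero]
  · rw [coeff_C_mul]
    exact Nat.mul_le_mul_left _ (hf.2 j)

theorem X_pow_mul (hf : CoeffBound f i c) (k : ℕ) : CoeffBound (X ^ k * f) (k + i) c := by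
  refine ⟨fun j hj => ?_, fun j => ?_⟩ <;> rw [coeff_X_pow_mul']
  · split_ifs with h
    exacts [hf.1 _ (by omega), rfl]
  · split_ifs with h
    exacts [hf.2 _, Nat.zero_le _]

theorem mul (hf : CoeffBound f i c) (hg : CoeffBound g i c') :
    CoeffBound (f * g) (2 * i) (2 * i * (c * c')) := by
  have h0 : ∀ j, 2 * i ≤ j → (f * g).coeff j = 0 := fun j hj => by
    rw [coeff_mul]
    refine Finset.sum_eq_zero fun x hx => ?_
    rw [Finset.HasAntidiagonal.mem_antidiagonal] at hx
    rcases le_or_gt i x.1 with h | h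
    · rw [hf.1 _ h, zero_mul]
    · rw [hg.1 x.2 (by omega), mul_zero]
  refine ⟨h0, fun j => ?_⟩
  rcases le_or_gt (2 * i) j with hj | hj
  · rw [h0 j hj]
    exact Nat.zero_le _
  · rw [coeff_mul]
    refine (Finset.sum_le_card_nsmul _ _ (c * c') fun x _ =>
      Nat.mul_le_mul (hf.2 _) (hg.2 _)).trans ?_
    rw [Finset.Nat.card_antidiagonal, smul_eq_mul]
    exact Nat.mul_le_mul_right _ hj

theorem erase (hf : CoeffBound f (i + 1) c) : CoeffBound (f.erase i) i c := by
  refine ⟨fun j hj => ?_, fun j => ?_⟩ <;> rw [coeff_erase]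
  · split_ifs with h
    exacts [rfl, hf.1 _ (by omega)]
  · split_ifs with h
    exacts [Nat.zero_le _, hf.2 _]

/-- Coefficients below B are the base-B digits of the value at B, so no carries occur. -/
theorem eval_lt (hf : CoeffBound f i c) (hc : c < B) : f.eval B < B ^ i := by
  induction i generalizing f with
  | zero =>
    have : f = 0 := Polynomial.ext fun j => by rw [hf.1 j (Nat.zero_le _), coeff_zero]
    simp [this]
  | succ i ih =>
    rw [← monomial_add_erase f i, eval_add, eval_monomial]
    have h1 := ih hf.erase
    have h2 := Nat.mul_le_mul_right (B ^ i) ((hf.2 i).trans_lt hc)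
    rw [Nat.succ_mul] at h2
    rw [pow_succ']
    omega

theorem eval_div_mod (hf : CoeffBound f (i + 1) c) (hc : c < B) :
    f.eval B / B ^ i = f.coeff i ∧ f.eval B % B ^ i = (f.erase i).eval B := by
  have h1 := hf.erase.eval_lt hc
  have h2 : f.eval B = (f.erase i).eval B + B ^ i * f.coeff i := by
    conv_lhs => rw [← monomial_add_erase f i, eval_add, eval_monomial]
    ring
  rw [h2, Nat.add_mul_mod_self_left, Nat.mod_eq_of_lt h1,
    Nat.add_mul_div_left _ _ (by omega), Nat.div_eq_of_lt h1, zero_add]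
  exact ⟨rfl, rfl⟩

theorem eq_zero (hf : CoeffBound f 0 c) : f = 0 :=
  Polynomial.ext fun j => by rw [hf.1 j (Nat.zero_le _), coeff_zero]

end CoeffBound

/-- The value at `ζ` of a polynomial over `ℕ`. -/
def natEval {K : Type*} [CommSemiring K] (ζ : K) : ℕ[X] →+* K := eval₂RingHom (Nat.castRingHom K) ζ

section
variable {K : Type*} [CommSemiring K] (ζ : K)

@[simp] theorem natEval_C (t : ℕ) : natEval ζ (C t) = t := by simp [natEval]

@[simp] theorem natEval_X : natEval ζ X = ζ := by simp [natEval]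

@[simp] theorem natEval_monomial (i t : ℕ) : natEval ζ (monomial i t) = t * ζ ^ i := by
  simp [natEval]

end

theorem eq_zero_of_eval_eq_zero {f : ℕ[X]} {B : ℕ} (hB : 0 < B) (h : f.eval B = 0) : f = 0 := by
  ext j
  rw [eval_eq_sum, Polynomial.sum, Finset.sum_eq_zero_iff] at h
  by_cases hj : j ∈ f.support
  · have := h j hj
    rw [coeff_zero]
    exact (Nat.mul_eq_zero.1 this).resolve_right (pow_pos hB j).ne'
  · simpa using hj

/-- The elements of the ring `K` of characteristic `p` are the values at `ζ` of the polynomials with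
`m` coefficients in `{0, …, p - 1}`, and `enc` gives the value of this polynomial at `B`. -/
structure IsEncoding {K : Type*} [CommRing K] (p m B : ℕ) (ζ : K) (enc : K → ℕ) : Prop where
  two_le : 2 ≤ p
  one_le : 1 ≤ m
  natCast_eq_zero : (p : K) = 0
  exists_poly : ∀ a, ∃ r : ℕ[X], CoeffBound r m (p - 1) ∧ natEval ζ r = a ∧ r.eval B = enc a
  eval_eq : ∀ r : ℕ[X], CoeffBound r m (p - 1) → r.eval B = enc (natEval ζ r)
  lt_base : 4 * m * p ^ 4 < B

/-- `x` packs `2 * m` coefficients, of moderate size, of a polynomial with value `a` at `ζ`. -/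
def IsPacked {K : Type*} [CommRing K] (p m B : ℕ) (ζ : K) (x : ℕ) (a : K) : Prop :=
  ∃ f : ℕ[X], CoeffBound f (2 * m) (2 * m * p ^ 2) ∧ f.eval B = x ∧ natEval ζ f = a

/-- The number `y` packs the coefficients of a polynomial of degree less than `m` that has the same
value at `ζ` as the `m`-th power of the variable. -/
def IsReduction {K : Type*} [CommRing K] (p m B : ℕ) (ζ : K) (y : ℕ) : Prop :=
  ∃ f : ℕ[X], CoeffBound f m (p ^ 3) ∧ f.eval B = y ∧ natEval ζ f = ζ ^ m

/-- The invariant of the reduction: the upper coefficients of the result `R` are found, and `x`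
packs the `i` coefficients that are still to be treated. -/
def ReductionInv {K : Type*} [CommRing K] (p m B : ℕ) (ζ : K) (a : K) (i x R : ℕ) : Prop :=
  i ≤ 2 * m ∧ ∃ f r : ℕ[X], CoeffBound f i (2 * m * p ^ 2 + (2 * m - i) * p ^ 4) ∧ f.eval B = x ∧
    CoeffBound r m (p - 1) ∧ (∀ j < i, r.coeff j = 0) ∧ r.eval B = R ∧ natEval ζ f + natEval ζ r = a

section
variable {K : Type*} [CommRing K] {p m B : ℕ} {ζ : K} {enc : K → ℕ}

theorem natCast_mod_of_natCast_eq_zero (hp : (p : K) = 0) (t : ℕ) : ((t % p : ℕ) : K) = t := by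
  conv_rhs => rw [← Nat.mod_add_div t p, Nat.cast_add, Nat.cast_mul, hp, zero_mul, add_zero]

namespace IsEncoding

theorem base_pos (h : IsEncoding p m B ζ enc) : 0 < B := by have := h.lt_base; omega

/-- The coefficients of a product are at most 2mp², and each of at most 2m reduction steps adds at
most p⁴; the base exceeds the total, so the digits stay separate throughout. -/
theorem bound_lt_base (h : IsEncoding p m B ζ enc) : 2 * m * p ^ 2 + 2 * m * p ^ 4 < B := by
  have h1 := h.lt_base
  have h2 := h.two_le
  have h3 : p ^ 2 ≤ p ^ 4 := Nat.pow_le_pow_right (by omega) (by omega)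
  nlinarith [Nat.mul_le_mul_left (2 * m) h3]

theorem lt_base' (h : IsEncoding p m B ζ enc) : p ≤ p ^ 3 ∧ p ^ 3 < B ∧ m < B := by
  have h1 := h.lt_base
  have h2 := h.two_le
  have h4 := h.one_le
  have h3 : p ^ 1 ≤ p ^ 3 := Nat.pow_le_pow_right (by omega) (by omega)
  have h5 : p ^ 3 ≤ p ^ 4 := Nat.pow_le_pow_right (by omega) (by omega)
  have h6 : 1 ≤ p ^ 3 := Nat.one_le_pow _ _ (by omega)
  have h7 := Nat.mul_le_mul (Nat.mul_le_mul_left 4 h4) h5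
  have h8 : 4 * m * 1 ≤ 4 * m * p ^ 4 := Nat.mul_le_mul_left _ (by omega)
  rw [pow_one] at h3
  rw [mul_one] at h7
  exact ⟨by omega, by omega, by omega⟩

theorem enc_lt (h : IsEncoding p m B ζ enc) (a : K) : enc a < B ^ m := by
  obtain ⟨r, h1, -, h2⟩ := h.exists_poly a
  rw [← h2]
  have := h.lt_base'
  exact h1.eval_lt (by omega)

theorem enc_eq_zero_iff (h : IsEncoding p m B ζ enc) (a : K) : enc a = 0 ↔ a = 0 := by
  constructor
  · intro h0
    obtain ⟨r, h1, h3, h2⟩ := h.exists_poly a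
    rw [h0] at h2
    rw [← h3, eq_zero_of_eval_eq_zero h.base_pos h2, map_zero]
  · rintro rfl
    have := h.eval_eq 0 .zero
    simpa using this.symm

theorem enc_one (h : IsEncoding p m B ζ enc) : enc 1 = 1 := by
  have h1 := h.two_le
  have h2 := h.one_le
  have := h.eval_eq 1 ⟨fun j hj => by rw [coeff_one, if_neg (by omega)], fun j => by
    rw [coeff_one]; split_ifs <;> omega⟩
  simpa using this.symm

theorem isPacked_mul (h : IsEncoding p m B ζ enc) (a b : K) :
    IsPacked p m B ζ (enc a * enc b) (a * b) := by
  obtain ⟨r, h1, h2, h3⟩ := h.exists_poly a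
  obtain ⟨s, h4, h5, h6⟩ := h.exists_poly b
  refine ⟨r * s, (h1.mul h4).mono le_rfl ?_, by rw [eval_mul, h3, h6], by rw [map_mul, h2, h5]⟩
  rw [sq]
  gcongr <;> omega

theorem le_bound (h : IsEncoding p m B ζ enc) : (p - 1) + (p - 1) ≤ 2 * m * p ^ 2 := by
  have h1 := h.two_le
  have h2 := h.one_le
  have h3 : p ^ 1 ≤ p ^ 2 := Nat.pow_le_pow_right (by omega) (by omega)
  rw [pow_one] at h3
  have h4 := Nat.mul_le_mul (Nat.mul_le_mul_left 2 h2) h3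
  omega

theorem isPacked_add (h : IsEncoding p m B ζ enc) (a b : K) :
    IsPacked p m B ζ (enc a + enc b) (a + b) := by
  obtain ⟨r, h1, h2, h3⟩ := h.exists_poly a
  obtain ⟨s, h4, h5, h6⟩ := h.exists_poly b
  exact ⟨r + s, (h1.add h4).mono (by omega) h.le_bound, by rw [eval_add, h3, h6],
    by rw [map_add, h2, h5]⟩

/-- Adding p - 1 to the constant digit subtracts 1 without leaving the natural numbers. -/
theorem isPacked_sub_one (h : IsEncoding p m B ζ enc) (a : K) :
    IsPacked p m B ζ (enc a + (p - 1)) (a - 1) := by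
  have hp := h.two_le
  have hm := h.one_le
  obtain ⟨r, h1, h2, h3⟩ := h.exists_poly a
  refine ⟨r + C (p - 1), (h1.add (c' := p - 1) ⟨fun j hj => ?_, fun j => ?_⟩).mono (by omega)
    h.le_bound, by rw [eval_add, h3, eval_C], ?_⟩
  · rw [coeff_C, if_neg (by omega)]
  · rw [coeff_C]
    split_ifs <;> omega
  · rw [map_add, h2, natEval_C, Nat.cast_sub (by omega), h.natCast_eq_zero]
    simp [sub_eq_add_neg]

end IsEncoding

namespace ReductionInv

theorem init {a : K} {x : ℕ} (h : IsPacked p m B ζ x a) :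
    ReductionInv p m B ζ a (2 * m) x 0 := by
  obtain ⟨f, h1, h2, h3⟩ := h
  exact ⟨le_rfl, f, 0, h1.mono le_rfl (by omega), h2, .zero, by simp, by simp, by simp [h3]⟩

theorem final {a : K} {x R : ℕ} (he : IsEncoding p m B ζ enc)
    (h : ReductionInv p m B ζ a 0 x R) : R = enc a := by
  obtain ⟨-, f, r, h1, h2, h3, h4, h5, h6⟩ := h
  rw [h1.eq_zero, map_zero, zero_add] at h6
  rw [← h5, he.eval_eq r h3, h6]

theorem lt {a : K} {i x R : ℕ} (he : IsEncoding p m B ζ enc)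
    (h : ReductionInv p m B ζ a i x R) : x < B ^ i ∧ R < B ^ m := by
  obtain ⟨h0, f, r, h1, rfl, h3, h4, rfl, h6⟩ := h
  have h7 := he.bound_lt_base
  have h8 : (2 * m - i) * p ^ 4 ≤ 2 * m * p ^ 4 := Nat.mul_le_mul_right _ (by omega)
  have := he.lt_base'
  exact ⟨h1.eval_lt (by omega), h3.eval_lt (by omega)⟩

/-- The top term is rewritten by X^i = X^(i-m) X^m and the relation for ζ^m. Its coefficient is
first reduced modulo p, so that the others grow by at most p · p³. -/
theorem step_high {a : K} {i x R y : ℕ} (he : IsEncoding p m B ζ enc)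
    (hy : IsReduction p m B ζ y) (hi : m ≤ i) (h : ReductionInv p m B ζ a (i + 1) x R) :
    ReductionInv p m B ζ a i (x % B ^ i + x / B ^ i % p * y * B ^ (i - m)) R := by
  obtain ⟨h0, f, r, h1, rfl, h3, h4, h5, h6⟩ := h
  obtain ⟨g, h7, rfl, h8⟩ := hy
  have hb := he.bound_lt_base
  have hp := he.two_le
  have hle : (2 * m - (i + 1)) * p ^ 4 ≤ 2 * m * p ^ 4 := Nat.mul_le_mul_right _ (by omega)
  obtain ⟨hd, hm⟩ := h1.eval_div_mod (B := B) (by omega)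
  rw [hd, hm]
  refine ⟨by omega, f.erase i + X ^ (i - m) * (C (f.coeff i % p) * g), r, ?_, ?_, h3,
    fun j hj => h4 j (by omega), h5, ?_⟩
  · have h9 := (h7.C_mul (f.coeff i % p)).X_pow_mul (i - m)
    rw [Nat.sub_add_cancel hi] at h9
    refine (h1.erase.add h9).mono le_rfl ?_
    have h10 : f.coeff i % p * p ^ 3 ≤ p * p ^ 3 :=
      Nat.mul_le_mul_right _ (Nat.mod_lt _ (by omega)).le
    rw [show 2 * m - i = (2 * m - (i + 1)) + 1 by omega, add_mul, one_mul, pow_succ' p 3]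
    omega
  · simp only [eval_add, eval_mul, eval_pow, eval_X, eval_C]
    ring
  · rw [← h6, map_add, map_mul, map_mul, map_pow, natEval_X, natEval_C, h8,
      natCast_mod_of_natCast_eq_zero he.natCast_eq_zero]
    conv_rhs => rw [← monomial_add_erase f i, map_add, natEval_monomial]
    have : ζ ^ i = ζ ^ (i - m) * ζ ^ m := by rw [← pow_add, Nat.sub_add_cancel hi]
    rw [this]
    ring

/-- Below degree m the top digit, reduced modulo p, is final; it moves to a place of the result that
is still 0. -/
theorem step_low {a : K} {i x R : ℕ} (he : IsEncoding p m B ζ enc)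
    (hi : i < m) (h : ReductionInv p m B ζ a (i + 1) x R) :
    ReductionInv p m B ζ a i (x % B ^ i) (R + x / B ^ i % p * B ^ i) := by
  obtain ⟨h0, f, r, h1, rfl, h3, h4, rfl, h6⟩ := h
  have hb := he.bound_lt_base
  have hp := he.two_le
  have hle : (2 * m - (i + 1)) * p ^ 4 ≤ 2 * m * p ^ 4 := Nat.mul_le_mul_right _ (by omega)
  have hle' : (2 * m - (i + 1)) * p ^ 4 ≤ (2 * m - i) * p ^ 4 :=
    Nat.mul_le_mul_right _ (by omega)
  obtain ⟨hd, hm⟩ := h1.eval_div_mod (B := B) (by omega)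
  rw [hd, hm]
  have hlt : f.coeff i % p < p := Nat.mod_lt _ (by omega)
  refine ⟨by omega, f.erase i, r + monomial i (f.coeff i % p), h1.erase.mono le_rfl (by omega), rfl,
    ⟨fun j hj => ?_, fun j => ?_⟩, fun j hj => ?_, ?_, ?_⟩
  · rw [coeff_add, h3.1 j hj, coeff_monomial, if_neg (by omega), add_zero]
  · rw [coeff_add, coeff_monomial]
    split_ifs with h
    · rw [h4 j (by omega)]
      omega
    · exact h3.2 j
  · rw [coeff_add, h4 j (by omega), coeff_monomial, if_neg (by omega), add_zero]
  · rw [eval_add, eval_monomial]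
  · rw [← h6, map_add, natEval_monomial,
      natCast_mod_of_natCast_eq_zero he.natCast_eq_zero]
    conv_rhs => rw [← monomial_add_erase f i, map_add, natEval_monomial]
    ring

end ReductionInv
end

/-! ### The encoding of 𝔽_p[y]/(u). -/

section AdjoinRoot
variable {p : ℕ} [hp : Fact p.Prime] (u : (ZMod p)[X]) [hu : Fact (Irreducible u)]

/-- The polynomial over `ℕ` with the first `m` coefficients of `f`. -/
noncomputable def natPoly (m : ℕ) (f : (ZMod p)[X]) : ℕ[X] :=
  ∑ i ∈ Finset.range m, monomial i (f.coeff i).val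

theorem coeff_natPoly (m : ℕ) (f : (ZMod p)[X]) (j : ℕ) :
    (natPoly m f).coeff j = if j < m then (f.coeff j).val else 0 := by
  simp [natPoly, coeff_monomial]

theorem coeffBound_natPoly (m : ℕ) (f : (ZMod p)[X]) : CoeffBound (natPoly m f) m (p - 1) := by
  have := fun j => ZMod.val_lt (f.coeff j)
  refine ⟨fun j hj => ?_, fun j => ?_⟩ <;> rw [coeff_natPoly]
  · rw [if_neg (by omega)]
  · split_ifs
    · have := this j
      omega
    · omega

theorem eval_natPoly (m : ℕ) (f : (ZMod p)[X]) (B : ℕ) :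
    (natPoly m f).eval B = ∑ i ∈ Finset.range m, (f.coeff i).val * B ^ i := by
  simp [natPoly, eval_finsetSum]

theorem natEval_natPoly (m : ℕ) (f : (ZMod p)[X]) :
    natEval (AdjoinRoot.root u) (natPoly m f) =
      ∑ i ∈ Finset.range m, algebraMap (ZMod p) _ (f.coeff i) * AdjoinRoot.root u ^ i := by
  simp only [natPoly, map_sum, natEval_monomial]
  refine Finset.sum_congr rfl fun i _ => ?_
  rw [← map_natCast (algebraMap (ZMod p) (AdjoinRoot u)), ZMod.natCast_zmod_val]

theorem natEval_root (r : ℕ[X]) :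
    natEval (AdjoinRoot.root u) r = AdjoinRoot.mk u (r.map (Nat.castRingHom (ZMod p))) := by
  rw [← AdjoinRoot.aeval_eq, aeval_def, eval₂_map, natEval, coe_eval₂RingHom]
  congr 1

theorem natEval_natPoly_of_natDegree_lt {m : ℕ} {f : (ZMod p)[X]} (hf : f.degree < m) :
    natEval (AdjoinRoot.root u) (natPoly m f) = AdjoinRoot.mk u f := by
  rw [natEval_root]
  congr 1
  ext j
  rw [coeff_map, coeff_natPoly]
  split_ifs with h
  · rw [eq_natCast, ZMod.natCast_zmod_val]
  · rw [map_zero, coeff_eq_zero_of_degree_lt (hf.trans_le (by exact_mod_cast not_lt.1 h))]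

theorem exists_degree_lt_mk_eq (a : AdjoinRoot u) :
    ∃ f : (ZMod p)[X], f.degree < u.degree ∧ AdjoinRoot.mk u f = a := by
  obtain ⟨f, rfl⟩ := AdjoinRoot.mk_surjective a
  refine ⟨f % u, degree_mod_lt f hu.out.ne_zero, ?_⟩
  rw [AdjoinRoot.mk_eq_mk]
  exact ⟨-(f / u), by rw [mul_neg, EuclideanDomain.mod_eq_sub_mul_div]; ring⟩

theorem eq_of_mk_eq_of_degree_lt {f g : (ZMod p)[X]} (hf : f.degree < u.degree)
    (hg : g.degree < u.degree) (h : AdjoinRoot.mk u f = AdjoinRoot.mk u g) : f = g := by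
  rw [AdjoinRoot.mk_eq_mk] at h
  rw [← sub_eq_zero]
  exact eq_zero_of_dvd_of_degree_lt h ((degree_sub_le f g).trans_lt (max_lt hf hg))

/-- The coefficients of the representative of degree less than that of `u`, as digits in base `B`. -/
noncomputable def encode (B : ℕ) (a : AdjoinRoot u) : ℕ :=
  (natPoly u.natDegree (exists_degree_lt_mk_eq u a).choose).eval B

theorem encode_mk (B : ℕ) {f : (ZMod p)[X]} (hf : f.degree < u.degree) :
    encode u B (AdjoinRoot.mk u f) = (natPoly u.natDegree f).eval B := by
  have h := (exists_degree_lt_mk_eq u (AdjoinRoot.mk u f)).choose_spec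
  rw [encode, eq_of_mk_eq_of_degree_lt u h.1 hf h.2]

theorem isEncoding_encode {B : ℕ} (hB : 4 * u.natDegree * p ^ 4 < B) :
    IsEncoding p u.natDegree B (AdjoinRoot.root u) (encode u B) where
  two_le := hp.out.two_le
  one_le := hu.out.natDegree_pos
  natCast_eq_zero := by
    rw [← map_natCast (algebraMap (ZMod p) (AdjoinRoot u)), ZMod.natCast_self, map_zero]
  exists_poly a := by
    obtain ⟨f, hf, rfl⟩ := exists_degree_lt_mk_eq u a
    refine ⟨natPoly u.natDegree f, coeffBound_natPoly _ _,
      natEval_natPoly_of_natDegree_lt u (hf.trans_le degree_le_natDegree), ?_⟩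
    rw [encode_mk u B hf]
  eval_eq r hr := by
    have hd : (r.map (Nat.castRingHom (ZMod p))).degree < u.degree := by
      rw [degree_eq_natDegree hu.out.ne_zero, degree_lt_iff_coeff_zero]
      intro j hj
      rw [coeff_map, hr.1 j hj, map_zero]
    rw [natEval_root, encode_mk u B hd]
    congr 1
    ext j
    rw [coeff_natPoly]
    split_ifs with h
    · rw [coeff_map, Nat.coe_castRingHom, ZMod.val_natCast, Nat.mod_eq_of_lt]
      have := hr.2 j
      have := hp.out.two_le
      omega
    · exact hr.1 j (not_lt.1 h)
  lt_base := hB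

/-- The relation u(ζ) = 0, divided by the leading coefficient (u need not be monic), expresses ζ^m
by lower powers; the sign -1 is represented by p - 1. -/
theorem isReduction_natPoly {B c : ℕ}
    (hc : (c : ZMod p) * u.leadingCoeff = 1) (hcp : c ≤ p) :
    IsReduction p u.natDegree B (AdjoinRoot.root u)
      ((p - 1) * c * (natPoly u.natDegree u).eval B) := by
  have hp2 := hp.out.two_le
  refine ⟨C ((p - 1) * c) * natPoly u.natDegree u,
    ((coeffBound_natPoly _ _).C_mul _).mono le_rfl ?_, by rw [eval_mul, eval_C], ?_⟩
  · rw [show p ^ 3 = p * p * p by ring]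
    gcongr <;> omega
  · rw [map_mul, natEval_C, natEval_natPoly, Nat.cast_mul, Nat.cast_sub (by omega),
      Nat.cast_one]
    have h1 : (p : AdjoinRoot u) = 0 := by
      rw [← map_natCast (algebraMap (ZMod p) (AdjoinRoot u)), ZMod.natCast_self, map_zero]
    have h2 := AdjoinRoot.aeval_eq u (f := u)
    rw [AdjoinRoot.mk_self, aeval_eq_sum_range, Finset.sum_range_succ] at h2
    simp only [Algebra.smul_def] at h2
    have h3 := congrArg (algebraMap (ZMod p) (AdjoinRoot u)) hc
    rw [map_mul, map_natCast, map_one] at h3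
    rw [← leadingCoeff] at h2
    rw [eq_neg_of_add_eq_zero_left h2, h1]
    linear_combination AdjoinRoot.root u ^ u.natDegree * h3

end AdjoinRoot

/-! ### Programs for field arithmetic: reduction and powers. -/

namespace RAM

/-- Replaces the packed polynomial in register 100 by the encoding of its value. -/
def redProg : Prog := block [
  .const 101 0,
  .op .add 102 4 4,
  .copy 103 9,
  .whileNZ 102 (block [
    .op .sub 102 102 12,
    .op .div 103 103 7,
    .op .div 104 100 103,
    .op .mod 104 104 1,
    .op .mod 100 100 103,
    .op .div 105 103 8,
    .ifNZ 105
      (block [.op .mul 104 104 10, .op .mul 104 104 105, .op .add 100 100 104])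
      (block [.op .mul 104 104 103, .op .add 101 101 104])]),
  .copy 100 101]

/-- Registers are layered: constants lie below 40, and the decoding, the Frobenius sum, powers and
reduction work from 40, 60, 80 and 100 on. Preservation of the registers below 100 thus protects the
data of all callers. -/
theorem wp_redProg {K : Type*} [CommRing K] {p m B M y : ℕ} {ζ : K} {enc : K → ℕ} {c : Store}
    (he : IsEncoding p m B ζ enc) (hy : IsReduction p m B ζ y) (hM : B ^ (2 * m + 2) ≤ 2 ^ M)
    (h1 : c.reg 1 = p) (h4 : c.reg 4 = m) (h7 : c.reg 7 = B) (h8 : c.reg 8 = B ^ m)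
    (h9 : c.reg 9 = B ^ (2 * m)) (h10 : c.reg 10 = y) (h12 : c.reg 12 = 1)
    {s : Store} {n : ℕ} {a : K} (hs : Agree 40 s c) (hx : IsPacked p m B ζ (s.reg 100) a) :
    Wp M redProg n s fun s' n' => s'.reg 100 = enc a ∧ Agree 100 s' s ∧ n' ≤ n + 80 * m + 20 := by
  have hB : 1 < B := by have := he.lt_base'; have := he.two_le; omega
  have hlt : ∀ {x k}, x < B ^ k → k ≤ 2 * m + 2 → x < 2 ^ M := fun hx hk =>
    hx.trans_le ((Nat.pow_le_pow_right he.base_pos hk).trans hM)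
  have hpow : ∀ k, k < 2 * m + 2 → B ^ k < 2 ^ M := fun k hk =>
    (Nat.pow_lt_pow_right hB hk).trans_le hM
  have hBM : B < 2 ^ M := by simpa using hpow 1 (by omega)
  obtain ⟨hpB, hp3, hmB⟩ := he.lt_base'
  have hm1 := he.one_le
  have hyB : y < B ^ m := by
    obtain ⟨f, hf, rfl, -⟩ := hy
    exact hf.eval_lt hp3
  have h2m : 2 * m < 2 ^ M := by
    have : 2 * m < B ^ 2 := by
      rw [sq]; nlinarith
    exact hlt this (by omega)
  simp only [redProg, wp_block_cons, wp_const, wp_op, wp_copy, wp_block_nil]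
  simp [BinOp.eval, hs.1, h1, h4, h7, h8, h9, h10, h12]
  refine ⟨by omega, hpow _ (by omega), ?_⟩
  refine wp_while 30 (fun k s' => Agree 100 s' s ∧ s'.reg 102 = k ∧ s'.reg 103 = B ^ k ∧
    ReductionInv p m B ζ a k (s'.reg 100) (s'.reg 101)) (2 * m) ?_ ?_ ?_ ?_ ?_
  · simpa [Agree.refl, two_mul] using ReductionInv.init hx
  · rintro k s' ⟨-, hk, -, hinv⟩
    rw [hk]
    exact hinv.1.trans_lt h2m
  · exact fun s' h => h.2.1
  · rintro k s' ⟨ha, hk, hBk, hinv⟩ - n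
    have hc := (ha.mono (show 40 ≤ 100 by norm_num)).trans hs
    have hdiv : B ^ (k + 1) / B = B ^ k := by
      rw [pow_succ, Nat.mul_div_cancel _ he.base_pos]
    have hk2 := hinv.1
    obtain ⟨hx1, hR⟩ := hinv.lt he
    have hB0 : B ≠ 0 := by omega
    have hxM := hlt hx1 (by omega)
    have hM0 : M ≠ 0 := by rintro rfl; omega
    have hdM : ∀ d, s'.reg 100 / d < 2 ^ M := fun d => (Nat.div_le_self _ _).trans_lt hxM
    have hmM : ∀ d, s'.reg 100 % d < 2 ^ M := fun d => (Nat.mod_le _ _).trans_lt hxM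
    have hdp : s'.reg 100 / B ^ k % p < B :=
      (Nat.mod_lt _ (by have := he.two_le; omega)).trans (by omega)
    have hk1M : k + 1 < 2 ^ M := by omega
    have hb1 := hpow k (by omega)
    have hb2 := hpow (k + 1) (by omega)
    have hb3 := hpow m (by omega)
    have hpM : p < 2 ^ M := by omega
    have hyM := hlt hyB (by omega)
    have hdpM := hdp.trans hBM
    by_cases hkm : m ≤ k
    · have hz : B ^ k / B ^ m = B ^ (k - m) := Nat.pow_div hkm he.base_pos
      have hb4 := hpow (k - m) (by omega)
      have hb5 : ¬B ^ k < B ^ m := not_lt.2 (Nat.pow_le_pow_right he.base_pos hkm)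
      have hty : s'.reg 100 / B ^ k % p * y < B ^ (m + 1) := by
        rw [pow_succ']
        exact Nat.mul_lt_mul'' hdp hyB
      have htyz : s'.reg 100 / B ^ k % p * y * B ^ (k - m) < B ^ (k + 1) := by
        rw [show k + 1 = (m + 1) + (k - m) by omega, pow_add]
        exact Nat.mul_lt_mul_of_pos_right hty (pow_pos he.base_pos _)
      simp [BinOp.eval, hc.1, h1, h4, h7, h8, h9, h10, h12, hk, hBk, hdiv, hz, hB0, ha, hdM, hmM,
        hinv.step_high he hy hkm, hk1M, hb1, hb2, hb3, hpM, hyM, hdpM, hM0, hBM, hxM, hb4, hb5, hlt hty (by omega), hlt htyz (by omega)]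
    · have hz : B ^ k / B ^ m = 0 := Nat.div_eq_of_lt (Nat.pow_lt_pow_right hB (by omega))
      have hb5 : ¬B ^ m ≤ B ^ k := not_le.2 (Nat.pow_lt_pow_right hB (by omega))
      have htz : s'.reg 100 / B ^ k % p * B ^ k < B ^ (k + 1) := by
        rw [pow_succ']
        exact Nat.mul_lt_mul_of_pos_right hdp (pow_pos he.base_pos _)
      simp [BinOp.eval, hc.1, h1, h4, h7, h8, h9, h10, h12, hk, hBk, hdiv, hz, hB0, ha, hdM, hmM,
        hinv.step_low he (not_le.1 hkm), hk1M, hb1, hb2, hb3, hpM, hyM, hdpM, hM0, hBM, hxM, hb5, hlt htz (by omega), hlt hR (by omega)]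
  · rintro s' n' k ⟨ha, hk, hBk, hinv⟩ h0 hn
    obtain rfl : k = 0 := by omega
    have := hinv.final he
    simp [this, ha, hlt (he.enc_lt a) (by omega)]
    omega
/-- In the presence of the constants `c` (registers below 40 and memory), the program `R` replaces
products of two encoded elements by encoded elements, in at most `T` steps. -/
structure IsMulProg {K : Type*} [CommRing K] (M T : ℕ) (R : Prog) (c : Store) (enc : K → ℕ) :
    Prop where
  two_le : 2 ≤ M
  enc_one : enc 1 = 1
  enc_lt : ∀ a, enc a < 2 ^ M
  reg_one : c.reg 12 = 1
  reg_two : c.reg 13 = 2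
  wp_mul : ∀ (s : Store) (n : ℕ) (a b : K), Agree 40 s c → s.reg 100 = enc a * enc b →
    Wp M R n s fun s' n' => s'.reg 100 = enc (a * b) ∧ Agree 100 s' s ∧ n' ≤ n + T

/-- Squares the element in register 80 and halves the number in register 81. -/
def squareProg (R : Prog) : Prog := block [
  .op .mul 100 80 80, R, .copy 80 100, .op .div 81 81 13]

/-- Puts the power of the element in register 80 with the exponent in register 81 into
register 82. -/
def powProg (R : Prog) : Prog := block [
  .const 82 1,
  .whileNZ 81 (block [
    .op .mod 83 81 13,
    .ifNZ 83 (block [.op .mul 100 82 80, R, .copy 82 100]) .skip,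
    squareProg R])]

/-- Square-and-multiply: the product b' a'^E' remains constant while E' is halved, and M rounds
exhaust an exponent below 2^M. -/
theorem wp_powProg {K : Type*} [CommRing K] {M T : ℕ} {R : Prog} {c : Store} {enc : K → ℕ}
    (hR : IsMulProg M T R c enc) {s : Store} {n : ℕ} {a : K} {E : ℕ} (hs : Agree 40 s c)
    (h80 : s.reg 80 = enc a) (h81 : s.reg 81 = E) (hE : E < 2 ^ M) :
    Wp M (powProg R) n s fun s' n' =>
      s'.reg 82 = enc (a ^ E) ∧ Agree 80 s' s ∧ n' ≤ n + M * (2 * T + 40) + 10 := by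
  have hM := hR.two_le
  have hM2 : 2 < 2 ^ M := (show 2 < 2 ^ 2 by norm_num).trans_le (Nat.pow_le_pow_right (by omega) hM)
  have hM0 : M ≠ 0 := by omega
  simp [powProg, hM0]
  refine wp_while (2 * T + 30) (fun k s' => Agree 80 s' s ∧ ∃ a' b' E', s'.reg 80 = enc a' ∧
    s'.reg 82 = enc b' ∧ s'.reg 81 = E' ∧ E' < 2 ^ k ∧ E' < 2 ^ M ∧ b' * a' ^ E' = a ^ E) M
    ?_ ?_ ?_ ?_ ?_
  · simp [Agree.refl]
    exact ⟨a, h80, 1, hR.enc_one.symm, by rw [h81]; exact hE, by rw [h81, one_mul]⟩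
  · rintro k s' ⟨-, a', b', E', -, -, rfl, -, h, -⟩
    exact h
  · rintro s' ⟨-, a', b', E', -, -, rfl, h, -, -⟩
    simpa using h
  · rintro k s' ⟨hs', a', b', E', h1, h2, h3, h4, h5, h6⟩ h0 n
    have hc := (hs'.mono (show 40 ≤ 80 by norm_num)).trans hs
    -- The squaring and halving are common to both parities of the exponent, so they are treated
    -- once.
    have hstep : ∀ (s₁ : Store) (n₁ : ℕ) (b₁ : K), Agree 80 s₁ s → s₁.reg 80 = enc a' →
        s₁.reg 82 = enc b₁ → s₁.reg 81 = E' → b₁ * (a' * a') ^ (E' / 2) = a ^ E →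
        n₁ ≤ n + T + 20 →
        Wp M (squareProg R) n₁ s₁
          fun s' n' => (Agree 80 s' s ∧ ∃ a' b' E', s'.reg 80 = enc a' ∧
            s'.reg 82 = enc b' ∧ s'.reg 81 = E' ∧ E' < 2 ^ k ∧ E' < 2 ^ M ∧
            b' * a' ^ E' = a ^ E) ∧ n' < n + (2 * T + 30) := by
      intro s₁ n₁ b₁ ha₁ g1 g2 g3 g4 g5
      have hc₁ := (ha₁.mono (show 40 ≤ 80 by norm_num)).trans hs
      simp [squareProg, g1, hR.enc_lt, BinOp.eval]
      refine (hR.wp_mul _ _ a' a' (by simpa using hc₁) (by simp)).mono ?_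
      rintro s₂ n₂ ⟨h100, ha, hn⟩
      have ha₂ : Agree 100 s₂ s₁ := by simpa using ha
      simp [h100, hR.enc_lt, ha₂.1, g2, g3, BinOp.eval, hc₁.1, hR.reg_two, hM2, h5,
        (ha₂.mono (show 80 ≤ 100 by norm_num)).trans ha₁]
      refine ⟨⟨a' * a', rfl, b₁, rfl, ?_, ?_, g4⟩, by omega⟩
      · exact Nat.div_lt_of_lt_mul (by rwa [pow_succ'] at h4)
      · exact (Nat.div_le_self _ _).trans_lt h5
    have hodd := Nat.mod_add_div E' 2
    simp [BinOp.eval, h3, hc.1, hR.reg_two, hM2, h5, hM0]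
    refine ⟨by omega, fun hE1 => ?_, fun hE0 => ?_⟩
    · simp [h1, h2, hR.enc_lt]
      refine (hR.wp_mul _ _ b' a' (by simpa using hc) (by simp)).mono ?_
      rintro s₂ n₂ ⟨h100, ha, hn⟩
      have ha₂ : Agree 100 s₂ (s'.set 83 (E' % 2)) := by simpa using ha
      have ha₃ : Agree 80 s₂ s := by
        simpa using ((ha₂.mono (show 80 ≤ 100 by norm_num)).trans (hs'.set (by norm_num) _))
      simp [h100, hR.enc_lt]
      refine (hstep _ _ (b' * a') (by simpa using ha₃) (by simp [ha₂.1, h1]) (by simp)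
        (by simp [ha₂.1, h3]) ?_ (by omega)).mono ?_
      · rw [← h6, ← pow_two, ← pow_mul]
        conv_rhs => rw [← hodd, hE1, pow_add, pow_one, ← mul_assoc]
      · rintro s₄ n₄ ⟨⟨g1, c1, c2, c3, g2, g3, rfl, g5, g6, g7⟩, g8⟩
        exact ⟨⟨g1, c1, g2, c2, g3, g5, g6, g7⟩, g8⟩
    · refine (hstep _ _ b' (by simpa using hs') (by simp [h1]) (by simp [h2])
        (by simp [h3]) ?_ (by omega)).mono ?_
      · rw [← h6, ← pow_two, ← pow_mul]
        conv_rhs => rw [← hodd, hE0, zero_add]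
      · rintro s₄ n₄ ⟨⟨g1, c1, c2, c3, g2, g3, rfl, g5, g6, g7⟩, g8⟩
        exact ⟨⟨g1, c1, g2, c2, g3, g5, g6, g7⟩, g8⟩
  · rintro s' n' k ⟨ha, a', b', E', h1, h2, h3, h4, h5, h6⟩ h0 hn
    rw [← h3, h0, pow_zero, mul_one] at h6
    simp [h2, h6, ha]
    nlinarith
/-- Like `IsMulProg`, and `R` treats sums likewise. -/
structure IsArithProg {K : Type*} [CommRing K] (M T : ℕ) (R : Prog) (c : Store) (enc : K → ℕ) :
    Prop extends IsMulProg M T R c enc where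
  enc_eq_zero_iff : ∀ a, enc a = 0 ↔ a = 0
  wp_add : ∀ (s : Store) (n : ℕ) (a b : K), Agree 40 s c → s.reg 100 = enc a + enc b →
    Wp M R n s fun s' n' => s'.reg 100 = enc (a + b) ∧ Agree 100 s' s ∧ n' ≤ n + T

/-! ### Programs for the trace test and the decoding. -/

/-- Puts the Frobenius sum of the element in register 60 into register 61. -/
def frobeniusSumProg (R : Prog) : Prog := block [
  .const 61 0,
  .copy 62 3,
  .whileNZ 62 (block [
    .op .sub 62 62 12,
    .op .add 100 61 60,
    R,
    .copy 61 100,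
    .copy 80 60,
    .copy 81 5,
    powProg R,
    .copy 60 82])]

theorem wp_frobeniusSumProg {K : Type*} [CommRing K] {M T q D : ℕ} {R : Prog} {c : Store}
    {enc : K → ℕ} (hR : IsArithProg M T R c enc) (hq : c.reg 5 = q) (hD : c.reg 3 = D)
    (hqM : q < 2 ^ M) (hDM : D < 2 ^ M) {s : Store} {n : ℕ} {a : K} (hs : Agree 40 s c)
    (h60 : s.reg 60 = enc a) :
    Wp M (frobeniusSumProg R) n s fun s' n' =>
      s'.reg 61 = enc (frobeniusSum q D a) ∧ Agree 60 s' s ∧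
        n' ≤ n + D * (T + (M * (2 * T + 40) + 10) + 31) + 10 := by
  have hM := hR.two_le
  have hM2 : 2 < 2 ^ M := (show 2 < 2 ^ 2 by norm_num).trans_le (Nat.pow_le_pow_right (by omega) hM)
  have hM0 : M ≠ 0 := by omega
  simp [frobeniusSumProg, hM0, hs.1, hD, hDM]
  refine wp_while (T + (M * (2 * T + 40) + 10) + 30) (fun k s' => Agree 60 s' s ∧ k ≤ D ∧
    s'.reg 62 = k ∧ s'.reg 60 = enc (a ^ q ^ (D - k)) ∧
    s'.reg 61 = enc (frobeniusSum q (D - k) a)) D ?_ ?_ ?_ ?_ ?_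
  · simp [Agree.refl, h60, frobeniusSum, (hR.enc_eq_zero_iff 0).2]
  · rintro k s' ⟨-, h1, h2, -, -⟩
    omega
  · rintro s' ⟨-, h1, h2, -, -⟩
    exact h2
  · rintro k s' ⟨hs', h1, h2, h3, h4⟩ - n
    have hc := (hs'.mono (show 40 ≤ 60 by norm_num)).trans hs
    have hkM : k + 1 < 2 ^ M := by omega
    simp [BinOp.eval, h2, h3, h4, hc.1, hR.reg_one, hR.enc_lt, hkM, hM0]
    refine (hR.wp_add _ _ (frobeniusSum q (D - (k + 1)) a) (a ^ q ^ (D - (k + 1)))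
      (by simpa using hc) (by simp)).mono ?_
    rintro s₁ n₁ ⟨g1, g2, g3⟩
    simp only [Agree.set_iff_right, Nat.reduceLeDiff] at g2
    have gc : Agree 60 s₁ s := by
      simpa using (g2.mono (show 60 ≤ 100 by norm_num)).trans (hs'.set (by norm_num) k)
    have hc₁ := (gc.mono (show 40 ≤ 60 by norm_num)).trans hs
    simp [g1, g2.1, h3, hR.enc_lt, hc₁.1, hc.1, hq, hqM]
    refine (wp_powProg hR.toIsMulProg (a := a ^ q ^ (D - (k + 1))) (E := q) (by simpa using hc₁)
      (by simp) (by simp) hqM).mono ?_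
    rintro s₂ n₂ ⟨g4, g5, g6⟩
    simp only [Agree.set_iff_right, Nat.reduceLeDiff] at g5
    have g7 : Agree 60 s₂ s := by
      simpa using (g5.mono (show 60 ≤ 80 by norm_num)).trans (gc.set (by norm_num) _)
    have hk : D - k = (D - (k + 1)) + 1 := by omega
    simp [g4, hR.enc_lt, g7, g5.1, g2.1]
    refine ⟨⟨by omega, ?_, ?_⟩, by omega⟩
    · rw [hk, pow_succ, pow_mul]
    · rw [hk, frobeniusSum, frobeniusSum, Finset.sum_range_succ]
  · rintro s' n' k ⟨ha, h1, h2, h3, h4⟩ h0 hn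
    obtain rfl : k = 0 := by omega
    simp [h4, ha]
    rw [show T + (M * (2 * T + 40) + 10) + 30 + 1 = T + (M * (2 * T + 40) + 10) + 31 by ring] at hn
    omega

/-- Replaces the element in register 40 by its root, and the number in register 41 by the next
weight. -/
def rootProg (R : Prog) : Prog := block [
  .copy 80 40, .copy 81 17, powProg R, .copy 40 82, .op .mul 41 41 5]

/-- Divides the element in register 40 by the base, and adds the weight to register 42. -/
def divideProg (R : Prog) : Prog := block [
  .op .mul 100 40 15, R, .copy 40 100, .op .add 42 42 41]

/-- Finds the exponent of the element in register 40 and puts it into register 42. -/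
def decodeProg (R : Prog) : Prog := block [
  .const 41 1,
  .const 42 0,
  .copy 43 18,
  .whileNZ 43 (block [
    .op .sub 43 43 12,
    .op .mul 100 40 16,
    R,
    .copy 60 100,
    frobeniusSumProg R,
    .ifNZ 61 (rootProg R) (divideProg R)])]

/-- A bound on the running time of one step of the decoding. -/
def decodeTime (M T D : ℕ) : ℕ :=
  2 * T + (D * (T + (M * (2 * T + 40) + 10) + 31) + 10) + (M * (2 * T + 40) + 10) + 50

/-- These crude bounds hold for any w, so the size of the registers is controlled independently of
the correctness of the decoding. -/
theorem decodeStep_bounds {K : Type*} [CommRing K] {q D : ℕ} (hq : 1 ≤ q) (g w : K) (t : ℕ) :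
    ((decodeStep q D g)^[t] (w, 1, 0)).2.1 ≤ q ^ t ∧
      ((decodeStep q D g)^[t] (w, 1, 0)).2.2 ≤ t * q ^ t := by
  induction t with
  | zero => simp
  | succ t ih =>
    rw [Function.iterate_succ_apply']
    have h1 : q ^ t ≤ q ^ (t + 1) := Nat.pow_le_pow_right hq (by omega)
    have h2 : t * q ^ t ≤ t * q ^ (t + 1) := Nat.mul_le_mul_left _ h1
    rw [decodeStep, add_mul, one_mul]
    split_ifs
    · simp only
      omega
    · refine ⟨?_, ?_⟩
      · rw [pow_succ]
        exact Nat.mul_le_mul_right _ ih.1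
      · simp only
        omega

theorem wp_decodeProg {K : Type*} [CommRing K] {M T q D L : ℕ} {R : Prog} {c : Store}
    {enc : K → ℕ} (hR : IsArithProg M T R c enc) (hq : c.reg 5 = q) (hD : c.reg 3 = D) (g : K)
    (h15 : c.reg 15 = enc (g ^ (q ^ D - 2))) (h16 : c.reg 16 = enc (g ^ (q - 1) - 1))
    (h17 : c.reg 17 = q ^ (D - 1)) (h18 : c.reg 18 = L) (hq1 : 1 ≤ q)
    (hqM : q < 2 ^ M) (hDM : D < 2 ^ M) (hqDM : q ^ (D - 1) < 2 ^ M)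
    (hLM : (L + 1) * q ^ L < 2 ^ M) {s : Store} {n : ℕ} {w : K} (hs : Agree 40 s c)
    (h40 : s.reg 40 = enc w) :
    Wp M (decodeProg R) n s fun s' n' =>
      s'.reg 42 = ((decodeStep q D g)^[L] (w, 1, 0)).2.2 ∧
        n' ≤ n + L * (decodeTime M T D + 1) + 20 := by
  have hM := hR.two_le
  have hM2 : 2 < 2 ^ M := (show 2 < 2 ^ 2 by norm_num).trans_le (Nat.pow_le_pow_right (by omega) hM)
  have hM0 : M ≠ 0 := by omega
  have hpos : ∀ i, 1 ≤ q ^ i := fun i => Nat.one_le_pow _ _ hq1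
  have hLM' : L < 2 ^ M := by nlinarith [hpos L]
  have hbd : ∀ k, ((decodeStep q D g)^[L - k] (w, 1, 0)).2.1 < 2 ^ M ∧
      ((decodeStep q D g)^[L - k] (w, 1, 0)).2.2 < 2 ^ M := fun k => by
    have h1 := decodeStep_bounds hq1 (D := D) g w (L - k)
    have h2 : q ^ (L - k) ≤ q ^ L := Nat.pow_le_pow_right hq1 (by omega)
    have h3 : (L - k) * q ^ (L - k) ≤ L * q ^ L := Nat.mul_le_mul (by omega) h2
    rw [add_mul, one_mul] at hLM
    constructor <;> omega
  simp [decodeProg, hM0, hs.1, h18, hLM']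
  refine wp_while (decodeTime M T D) (fun k s' => Agree 40 s' s ∧ k ≤ L ∧
    s'.reg 43 = k ∧ s'.reg 40 = enc ((decodeStep q D g)^[L - k] (w, 1, 0)).1 ∧
    s'.reg 41 = ((decodeStep q D g)^[L - k] (w, 1, 0)).2.1 ∧
    s'.reg 42 = ((decodeStep q D g)^[L - k] (w, 1, 0)).2.2) L ?_ ?_ ?_ ?_ ?_
  · simp [Agree.refl, h40]
  · rintro k s' ⟨-, h1, h2, -, -⟩
    omega
  · rintro s' ⟨-, h1, h2, -, -⟩
    exact h2
  · rintro k s' ⟨hs', h1, h2, h3, h4, h5⟩ - n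
    have hbk := hbd (k + 1)
    have hk : L - k = (L - (k + 1)) + 1 := by omega
    rw [hk, Function.iterate_succ_apply']
    generalize (decodeStep q D g)^[L - (k + 1)] (w, 1, 0) = x at *
    obtain ⟨x₁, x₂, x₃⟩ := x
    simp only at h3 h4 h5 hbk
    have hc := hs'.trans hs
    have hkM : k + 1 < 2 ^ M := by omega
    simp [BinOp.eval, h2, h3, hc.1, hR.reg_one, h16, hR.enc_lt, hkM, hM0]
    refine (hR.wp_mul _ _ x₁ (g ^ (q - 1) - 1) (by simpa using hc) (by simp)).mono ?_
    rintro s₁ n₁ ⟨g1, g2, g3⟩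
    simp only [Agree.set_iff_right, Nat.reduceLeDiff] at g2
    simp [g1, hR.enc_lt]
    have hc₁ : Agree 40 s₁ c :=
      (g2.mono (show 40 ≤ 100 by norm_num)).trans (hc.set (by norm_num) _)
    refine (wp_frobeniusSumProg hR hq hD hqM hDM (a := x₁ * (g ^ (q - 1) - 1))
      (by simpa using hc₁) (by simp)).mono ?_
    rintro s₂ n₂ ⟨g4, g5, g6⟩
    simp only [Agree.set_iff_right, Nat.reduceLeDiff] at g5
    have hc₂ : Agree 40 s₂ c := (g5.mono (show 40 ≤ 60 by norm_num)).trans hc₁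
    have hs₂ := hc₂.trans hs.symm
    have r40 : s₂.reg 40 = enc x₁ := by simp [g5.1, g2.1, h3]
    have r41 : s₂.reg 41 = x₂ := by simp [g5.1, g2.1, h4]
    have r42 : s₂.reg 42 = x₃ := by simp [g5.1, g2.1, h5]
    have r43 : s₂.reg 43 = k := by simp [g5.1, g2.1]
    rw [g4]
    refine ⟨hR.enc_lt _, fun hne => ?_, fun heq => ?_⟩
    · rw [hR.enc_eq_zero_iff] at hne
      simp only [decodeStep, if_neg hne]
      simp [rootProg, r40, r41, hR.enc_lt, hc₂.1, h17, hqDM]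
      refine (wp_powProg hR.toIsMulProg (a := x₁) (E := q ^ (D - 1)) (by simpa using hc₂)
        (by simp) (by simp) hqDM).mono ?_
      rintro s₃ n₃ ⟨g7, g8, g9⟩
      simp only [Agree.set_iff_right, Nat.reduceLeDiff] at g8
      have hs₃ : Agree 40 s₃ s := (g8.mono (show 40 ≤ 80 by norm_num)).trans hs₂
      have hc₃ := hs₃.trans hs
      simp [g7, g8.1, hR.enc_lt, r40, r41, r42, r43, hs₃, hbk, hc₂.1, hq, hqM, BinOp.eval]
      unfold decodeTime
      omega
    · rw [hR.enc_eq_zero_iff] at heq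
      simp only [decodeStep, if_pos heq]
      simp [divideProg, r40, r41, hR.enc_lt, hc₂.1, h15, BinOp.eval]
      refine (hR.wp_mul _ _ x₁ (g ^ (q ^ D - 2)) (by simpa using hc₂) (by simp)).mono ?_
      rintro s₃ n₃ ⟨g7, g8, g9⟩
      simp only [Agree.set_iff_right, Nat.reduceLeDiff] at g8
      have hs₃ : Agree 40 s₃ s := (g8.mono (show 40 ≤ 100 by norm_num)).trans hs₂
      simp [g7, g8.1, hR.enc_lt, r40, r41, r42, r43, hs₃, hbk, BinOp.eval]
      unfold decodeTime
      omega
  · rintro s' n' k ⟨ha, h1, h2, h3, h4, h5⟩ h0 hn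
    obtain rfl : k = 0 := by omega
    refine ⟨?_, by omega⟩
    simpa using h5
-- Parameters, input and the complete program.
/-- Puts the power of register 60 with the exponent in register 61 into register 62. -/
def natPowProg : Prog := block [
  .const 62 1,
  .whileNZ 61 (block [.op .mul 62 62 60, .op .sub 61 61 12])]

/-- Repeated multiplication suffices, since the exponents d, n and dn are at most log₂(q^n). -/
theorem wp_natPowProg {M a E : ℕ} {s : Store} {n : ℕ} (h12 : s.reg 12 = 1) (h60 : s.reg 60 = a)
    (h61 : s.reg 61 = E) (ha : 1 ≤ a) (haM : a < 2 ^ M) (hE : E < 2 ^ M) (haE : a ^ E < 2 ^ M) :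
    Wp M natPowProg n s fun s' n' =>
      s'.reg 62 = a ^ E ∧ Agree 60 s' s ∧ n' ≤ n + E * 20 + 10 := by
  have hM0 : M ≠ 0 := by rintro rfl; omega
  simp [natPowProg, hM0]
  refine wp_while 10 (fun k s' => Agree 60 s' s ∧ k ≤ E ∧ s'.reg 61 = k ∧ s'.reg 60 = a ∧
    s'.reg 62 = a ^ (E - k)) E ?_ ?_ ?_ ?_ ?_
  · simp [Agree.refl, h60, h61]
  · rintro k s' ⟨-, h1, h2, -⟩
    omega
  · exact fun s' h => h.2.2.1
  · rintro k s' ⟨hs, h1, h2, h3, h4⟩ - n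
    have hk : k + 1 < 2 ^ M := by omega
    have hpow : a ^ (E - (k + 1)) < 2 ^ M :=
      (Nat.pow_le_pow_right ha (by omega)).trans_lt haE
    simp [BinOp.eval, h2, h3, h4, hs.1, h12, hs, hM0, haM, hk, hpow]
    refine ⟨by omega, ?_⟩
    rw [← pow_succ]
    congr 1
    omega
  · rintro s' n' k ⟨hs, h1, h2, h3, h4⟩ h0 hn
    obtain rfl : k = 0 := by omega
    simp [h4, hs]
    omega

/-- Packs the memory cells whose number is in register 61, from the address in register 60 on, into
register 62. -/
def packProg : Prog := block [
  .const 62 0,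
  .whileNZ 61 (block [
    .op .sub 61 61 12,
    .op .add 63 60 61,
    .load 64 63,
    .op .mul 62 62 7,
    .op .add 62 62 64])]

/-- Horner's scheme from the last cell down: with i cells left, register 62 packs the cells from a +
i on. -/
theorem wp_packProg {M B a k : ℕ} {s : Store} {n : ℕ} (h12 : s.reg 12 = 1) (h7 : s.reg 7 = B)
    (h60 : s.reg 60 = a) (h61 : s.reg 61 = k) (hM0 : M ≠ 0)
    (hmem : ∀ j < k, s.mem (a + j) < B) (hB : 1 ≤ B) (hBM : B ^ (k + 1) ≤ 2 ^ M)
    (hBM' : B < 2 ^ M) (hak : a + k < 2 ^ M) :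
    Wp M packProg n s fun s' n' =>
      s'.reg 62 = ∑ j ∈ Finset.range k, s.mem (a + j) * B ^ j ∧ Agree 60 s' s ∧
        n' ≤ n + k * 20 + 10 := by
  simp [packProg, hM0]
  refine wp_while 19 (fun i s' => Agree 60 s' s ∧ i ≤ k ∧ s'.reg 61 = i ∧ s'.reg 60 = a ∧
    s'.reg 62 = ∑ j ∈ Finset.range (k - i), s.mem (a + i + j) * B ^ j ∧
    s'.reg 62 < B ^ (k - i)) k ?_ ?_ ?_ ?_ ?_
  · simp [Agree.refl, h60, h61]
  · rintro i s' ⟨-, h1, h2, -⟩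
    omega
  · exact fun s' h => h.2.2.1
  · rintro i s' ⟨hs, h1, h2, h3, h4, h5⟩ - n
    have hi : i + 1 < 2 ^ M := by omega
    have hi' : i < 2 ^ M := by omega
    have hai : a + i < 2 ^ M := by omega
    have haM : a < 2 ^ M := by omega
    have hmi := hmem i (by omega)
    have hmiM := hmi.trans hBM'
    have h6 : s'.reg 62 * B + s.mem (a + i) < B ^ (k - i) := by
      rw [show k - i = (k - (i + 1)) + 1 by omega, pow_succ]
      nlinarith
    have h7M : s'.reg 62 * B < 2 ^ M := by
      have := Nat.pow_le_pow_right hB (show k - i ≤ k + 1 by omega)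
      omega
    have h8 : s'.reg 62 < 2 ^ M := by
      have := Nat.pow_le_pow_right hB (show k - (i + 1) ≤ k + 1 by omega)
      omega
    simp [BinOp.eval, h2, h3, hs.1, hs.2, h12, h7, hs, hM0, hi, hi', hai, haM, hBM', h8, h7M, h6,
      hmiM]
    refine ⟨by omega, ?_⟩
    rw [show k - i = (k - (i + 1)) + 1 by omega, Finset.sum_range_succ', h4, Finset.sum_mul]
    simp only [pow_zero, mul_one, add_zero]
    congr 1
    refine Finset.sum_congr rfl fun j _ => ?_
    rw [pow_succ, ← mul_assoc, show a + (i + 1) + j = a + i + (j + 1) by ring]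
  · rintro s' n' i ⟨hs, h1, h2, h3, h4, h5⟩ h0 hn
    obtain rfl : i = 0 := by omega
    simp [h4, hs]
    omega

/-- With this, `powProg` also works in the prime field, where it inverts the leading coefficient of
u. -/
theorem isMulProg_mod {p M : ℕ} [hp : Fact p.Prime] {c : Store} (hM : p * p < 2 ^ M)
    (h1 : c.reg 1 = p) (h12 : c.reg 12 = 1) (h13 : c.reg 13 = 2) :
    IsMulProg M 1 (.op .mod 100 100 1) c (ZMod.val : ZMod p → ℕ) := by
  have h2 := hp.out.two_le
  have hpM : p < 2 ^ M := by nlinarith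
  refine ⟨?_, ZMod.val_one p, fun a => (ZMod.val_lt a).trans hpM, h12, h13, ?_⟩
  · by_contra h
    have : 2 ^ M ≤ 2 ^ 1 := Nat.pow_le_pow_right (by omega) (by omega)
    omega
  · intro s n a b hs h100
    have : a.val * b.val < 2 ^ M :=
      lt_of_le_of_lt (Nat.mul_le_mul (ZMod.val_lt a).le (ZMod.val_lt b).le) hM
    simp [BinOp.eval, h100, hs.1, h1, hpM, this, ZMod.val_mul, Agree.refl]

theorem isArithProg_redProg {K : Type*} [CommRing K] {p m B M y : ℕ} {ζ : K} {enc : K → ℕ}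
    {c : Store} (he : IsEncoding p m B ζ enc) (hy : IsReduction p m B ζ y)
    (hM : B ^ (2 * m + 2) ≤ 2 ^ M)
    (h1 : c.reg 1 = p) (h4 : c.reg 4 = m) (h7 : c.reg 7 = B) (h8 : c.reg 8 = B ^ m)
    (h9 : c.reg 9 = B ^ (2 * m)) (h10 : c.reg 10 = y) (h12 : c.reg 12 = 1) (h13 : c.reg 13 = 2) :
    IsArithProg M (80 * m + 20) redProg c enc := by
  have hB2 : 2 ≤ B := by have := he.lt_base'; have := he.two_le; omega
  have hlt : ∀ a, enc a < 2 ^ M := fun a => (he.enc_lt a).trans_le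
    ((Nat.pow_le_pow_right he.base_pos (by omega)).trans hM)
  refine ⟨⟨?_, he.enc_one, hlt, h12, h13, fun s n a b hs h => ?_⟩, he.enc_eq_zero_iff,
    fun s n a b hs h => ?_⟩
  · have h5 : 2 ^ 2 ≤ B ^ (2 * m + 2) :=
      (Nat.pow_le_pow_left hB2 2).trans (Nat.pow_le_pow_right he.base_pos (by omega))
    exact (Nat.pow_le_pow_iff_right (by omega)).1 (h5.trans hM)
  · refine (wp_redProg he hy hM h1 h4 h7 h8 h9 h10 h12 hs
      (h ▸ he.isPacked_mul a b)).mono fun s' n' h' => ?_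
    simpa only [add_assoc] using h'
  · refine (wp_redProg he hy hM h1 h4 h7 h8 h9 h10 h12 hs
      (h ▸ he.isPacked_add a b)).mono fun s' n' h' => ?_
    simpa only [add_assoc] using h'

/-- Computes the numerical parameters. -/
def numbersProg : Prog := block [
  .const 12 1, .const 13 2, .const 20 0,
  .load 1 20, .load 2 12, .load 3 13,
  .op .mul 4 2 3,
  .copy 60 1, .copy 61 2, natPowProg, .copy 5 62,
  .copy 60 5, .copy 61 3, natPowProg, .copy 6 62,
  .op .div 17 6 5,
  .op .mul 7 6 6, .op .mul 7 7 7, .op .mul 7 7 7,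
  .copy 60 7, .copy 61 4, natPowProg, .copy 8 62,
  .op .mul 9 8 8,
  .op .sub 18 3 12, .op .add 20 18 18, .op .add 18 18 20,
  .op .sub 20 1 12]

/-- The registers contain the numerical parameters. -/
def NumbersReady (p d n : ℕ) (s : Store) : Prop :=
  s.reg 1 = p ∧ s.reg 3 = n ∧ s.reg 4 = d * n ∧ s.reg 5 = p ^ d ∧ s.reg 6 = (p ^ d) ^ n ∧
    s.reg 7 = ((p ^ d) ^ n) ^ 8 ∧ s.reg 8 = (((p ^ d) ^ n) ^ 8) ^ (d * n) ∧
    s.reg 9 = (((p ^ d) ^ n) ^ 8) ^ (2 * (d * n)) ∧ s.reg 12 = 1 ∧ s.reg 13 = 2 ∧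
    s.reg 17 = (p ^ d) ^ (n - 1) ∧ s.reg 18 = 3 * (n - 1) ∧ s.reg 20 = p - 1

/-- The parameters satisfy the inequalities that the computations need. -/
structure Bounds (p d n M : ℕ) : Prop where
  two_le : 2 ≤ p
  d_pos : 1 ≤ d
  n_pos : 1 ≤ n
  le_pow : (((p ^ d) ^ n) ^ 8) ^ (2 * (d * n) + 2) ≤ 2 ^ M

namespace Bounds
variable {p d n M : ℕ} (h : Bounds p d n M)
include h

theorem d_le : d ≤ d * n := Nat.le_mul_of_pos_right _ h.n_pos
theorem n_le : n ≤ d * n := Nat.le_mul_of_pos_left _ h.d_pos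
theorem p_le : p ≤ p ^ d := Nat.le_self_pow (by have := h.d_pos; omega) _
theorem pow_le : p ^ d ≤ (p ^ d) ^ n := Nat.le_self_pow (by have := h.n_pos; omega) _

theorem lt_pow : d * n < (p ^ d) ^ n := by
  rw [← pow_mul]
  exact Nat.lt_pow_self h.two_le

theorem base_large : 64 * (p ^ d) ^ n ≤ ((p ^ d) ^ n) ^ 8 := by
  have h1 : 2 ≤ (p ^ d) ^ n := h.two_le.trans (h.p_le.trans h.pow_le)
  calc 64 * (p ^ d) ^ n ≤ ((p ^ d) ^ n) ^ 7 * (p ^ d) ^ n :=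
        Nat.mul_le_mul_right _ ((show 64 ≤ 2 ^ 7 by norm_num).trans (Nat.pow_le_pow_left h1 7))
    _ = _ := by ring

theorem base_sq_le : ((p ^ d) ^ n) ^ 8 * ((p ^ d) ^ n) ^ 8 ≤ 2 ^ M := by
  rw [← pow_two]
  refine le_trans (Nat.pow_le_pow_right ?_ (by omega)) h.le_pow
  have := h.base_large
  have := h.lt_pow
  omega

theorem base_lt : ((p ^ d) ^ n) ^ 8 < 2 ^ M := by
  have h1 := h.base_sq_le
  have h2 := h.base_large
  have h3 := h.lt_pow
  have h4 := Nat.mul_le_mul_right (((p ^ d) ^ n) ^ 8) (show 2 ≤ ((p ^ d) ^ n) ^ 8 by omega)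
  omega

theorem base_pow_lt {k : ℕ} (hk : k < 2 * (d * n) + 2) : (((p ^ d) ^ n) ^ 8) ^ k < 2 ^ M := by
  refine lt_of_lt_of_le (Nat.pow_lt_pow_right ?_ hk) h.le_pow
  have := h.base_large
  have := h.lt_pow
  omega

theorem lt_base : 4 * (d * n) * p ^ 4 < ((p ^ d) ^ n) ^ 8 := by
  have h1 : 2 ≤ (p ^ d) ^ n := h.two_le.trans (h.p_le.trans h.pow_le)
  have h2 : p ^ 4 ≤ ((p ^ d) ^ n) ^ 4 := Nat.pow_le_pow_left (h.p_le.trans h.pow_le) 4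
  have h3 := h.lt_pow
  calc 4 * (d * n) * p ^ 4 ≤ 4 * (p ^ d) ^ n * ((p ^ d) ^ n) ^ 4 := by gcongr
    _ = 4 * ((p ^ d) ^ n) ^ 5 := by ring
    _ < 2 ^ 3 * ((p ^ d) ^ n) ^ 5 := by
        have : 0 < ((p ^ d) ^ n) ^ 5 := by positivity
        omega
    _ ≤ ((p ^ d) ^ n) ^ 3 * ((p ^ d) ^ n) ^ 5 := by gcongr
    _ = _ := by ring

theorem decode_lt : (3 * (n - 1) + 1) * (p ^ d) ^ (3 * (n - 1)) < 2 ^ M := by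
  have h1 : 1 ≤ p ^ d := (by have := h.two_le; have := h.p_le; omega)
  have h2 : (p ^ d) ^ (3 * (n - 1)) ≤ ((p ^ d) ^ n) ^ 3 := by
    rw [← pow_mul (p ^ d)]
    exact Nat.pow_le_pow_right h1 (by omega)
  have h3 : ((p ^ d) ^ n) ^ 3 ≤ ((p ^ d) ^ n) ^ 8 :=
    Nat.pow_le_pow_right (h1.trans h.pow_le) (by omega)
  have h4 := h.lt_pow
  have h5 := h.n_le
  have h6 := h.base_large
  refine lt_of_lt_of_le (Nat.mul_lt_mul_of_lt_of_le (show 3 * (n - 1) + 1 < ((p ^ d) ^ n) ^ 8 by omega)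
    (h2.trans h3) (by positivity)) h.base_sq_le

end Bounds

theorem wp_numbersProg {p d n M : ℕ} (hb : Bounds p d n M) {s : Store} {t : ℕ}
    (h0 : s.mem 0 = p) (h1 : s.mem 1 = d) (h2 : s.mem 2 = n) :
    Wp M numbersProg t s fun s' t' =>
      NumbersReady p d n s' ∧ s'.mem = s.mem ∧ t' ≤ t + 60 * (d * n) + 200 := by
  have hp := hb.two_le
  have hd := hb.d_pos
  have hn := hb.n_pos
  have b1 := hb.p_le
  have b2 := hb.pow_le
  have b3 := hb.lt_pow
  have b4 := hb.base_large
  have b5 := hb.base_lt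
  have b6 := hb.d_le
  have b7 := hb.n_le
  have hM0 : M ≠ 0 := by rintro rfl; omega
  have hM2 : 2 < 2 ^ M := by omega
  have hpM : p < 2 ^ M := by omega
  have hdM : d < 2 ^ M := by omega
  have hnM : n < 2 ^ M := by omega
  have hqM : p ^ d < 2 ^ M := by omega
  have hNM : (p ^ d) ^ n < 2 ^ M := by omega
  simp [numbersProg, BinOp.eval, h0, h1, h2, hM0, hM2, hpM, hdM, hnM]
  refine (wp_natPowProg (a := p) (E := d) (by simp) (by simp) (by simp) (by omega) hpM hdM
    hqM).mono ?_
  rintro s₁ t₁ ⟨e1, f1, g1⟩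
  simp [e1, hqM, f1.1, hnM]
  refine (wp_natPowProg (a := p ^ d) (E := n) (by simp [f1.1]) (by simp) (by simp) (by omega) hqM
    hnM hNM).mono ?_
  rintro s₂ t₂ ⟨e2, f2, g2⟩
  have hN2 : (p ^ d) ^ n * (p ^ d) ^ n < 2 ^ M := by
    rw [← pow_two]
    exact (Nat.pow_le_pow_right (by omega) (by omega)).trans_lt b5
  have hN4 : (p ^ d) ^ n * (p ^ d) ^ n * ((p ^ d) ^ n * (p ^ d) ^ n) < 2 ^ M := by
    rw [← pow_two, ← pow_two, ← pow_mul]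
    exact (Nat.pow_le_pow_right (by omega) (by omega)).trans_lt b5
  have hN8 : (p ^ d) ^ n * (p ^ d) ^ n * ((p ^ d) ^ n * (p ^ d) ^ n) *
    ((p ^ d) ^ n * (p ^ d) ^ n * ((p ^ d) ^ n * (p ^ d) ^ n)) = ((p ^ d) ^ n) ^ 8 := by ring
  have hmM : d * n < 2 ^ M := by omega
  simp [e2, hNM, f1.1, f2.1, BinOp.eval, hqM, hN2, hN4, hN8, b5, hmM]
  refine (wp_natPowProg (a := ((p ^ d) ^ n) ^ 8) (E := d * n) (by simp [f1.1, f2.1]) (by simp)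
    (by simp) (by omega) b5 hmM (hb.base_pow_lt (by omega))).mono ?_
  rintro s₃ t₃ ⟨e3, f3, g3⟩
  have hBm := hb.base_pow_lt (k := d * n) (by omega)
  simp [e3, f1.1, f2.1, f3.1, BinOp.eval, hBm, hnM, hM0, hpM, NumbersReady, f1.2, f2.2, f3.2]
  have hdiv : (p ^ d) ^ n / p ^ d = (p ^ d) ^ (n - 1) := by
    refine Nat.div_eq_of_eq_mul_left (by omega) ?_
    rw [← pow_succ, Nat.sub_add_cancel hn]
  have hsq : (((p ^ d) ^ n) ^ 8) ^ (d * n) * (((p ^ d) ^ n) ^ 8) ^ (d * n) =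
      (((p ^ d) ^ n) ^ 8) ^ (2 * (d * n)) := by rw [← pow_add, two_mul]
  exact ⟨by omega, by omega, ⟨hsq, hdiv, by omega⟩, by omega⟩

/-- Reads the polynomials from the memory. -/
def readProg : Prog := block [
  .const 22 3, .copy 60 22, .copy 61 4, packProg, .copy 19 62,
  .op .add 60 22 4, .load 80 60, .op .sub 81 1 13, powProg (.op .mod 100 100 1),
  .op .mul 10 20 82, .op .mul 10 10 19,
  .op .add 22 22 4, .op .add 60 22 12, .copy 61 4, packProg, .copy 14 62,
  .op .add 22 22 4, .op .add 60 22 12, .copy 61 4, packProg, .copy 40 62]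

/-- Computes the constants for the decoding, decodes, and copies the result to register 0. -/
def solveProg : Prog := block [
  .copy 80 14, .op .sub 81 6 13, powProg redProg, .copy 15 82,
  .copy 80 14, .op .sub 81 5 12, powProg redProg, .op .add 100 82 20, redProg, .copy 16 100,
  decodeProg redProg,
  .copy 0 42]

/-- The algorithm for the discrete logarithm. -/
def dlogProg : Prog := block [numbersProg, readProg, solveProg]

/-- The result of reading the input: the reduction `y`, the base `x` and the power `w`. -/
def InputReady (p d n y x w : ℕ) (s : Store) : Prop :=
  NumbersReady p d n s ∧ s.reg 10 = y ∧ s.reg 14 = x ∧ s.reg 40 = w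

/-- Cells 0, 1, 2 hold p, d, n, and u takes m + 1 cells for m = dn, so v and w start at m + 4 and 2m
+ 4. The power with exponent p - 2 is the inverse of the leading coefficient, by Fermat. -/
theorem wp_readProg {p d n M : ℕ} [hp : Fact p.Prime] (hb : Bounds p d n M) {s : Store} {t : ℕ}
    (hs : NumbersReady p d n s) (u v w : (ZMod p)[X])
    (hu : ∀ j < d * n + 1, s.mem (3 + j) = (u.coeff j).val)
    (hv : ∀ j < d * n, s.mem (d * n + 4 + j) = (v.coeff j).val)
    (hw : ∀ j < d * n, s.mem (2 * (d * n) + 4 + j) = (w.coeff j).val) :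
    Wp M readProg t s fun s' t' =>
      InputReady p d n
        ((p - 1) * (u.coeff (d * n) ^ (p - 2)).val * (natPoly (d * n) u).eval (((p ^ d) ^ n) ^ 8))
        ((natPoly (d * n) v).eval (((p ^ d) ^ n) ^ 8))
        ((natPoly (d * n) w).eval (((p ^ d) ^ n) ^ 8)) s' ∧
      t' ≤ t + 60 * (d * n) + M * 50 + 200 := by
  have hp2 := hb.two_le
  have hd := hb.d_pos
  have hn := hb.n_pos
  have b1 := hb.p_le
  have b2 := hb.pow_le
  have b3 := hb.lt_pow
  have b4 := hb.base_large
  have b5 := hb.base_lt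
  have b6 := hb.d_le
  have b7 := hb.n_le
  have b8 := hb.base_sq_le
  have b9 := hb.le_pow
  obtain ⟨r1, r3, r4, r5, r6, r7, r8, r9, r12, r13, r17, r18, r20⟩ := hs
  have hval : ∀ x : ZMod p, x.val < p := ZMod.val_lt
  have hM0 : M ≠ 0 := by rintro rfl; omega
  generalize hB : ((p ^ d) ^ n) ^ 8 = B at *
  generalize hm : d * n = m at *
  have hmM : m < 2 ^ M := by omega
  have hpM : p < 2 ^ M := by omega
  have hBM : B ^ (m + 1) ≤ 2 ^ M := (Nat.pow_le_pow_right (by omega) (by omega)).trans b9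
  have hpp : p * p < 2 ^ M :=
    (Nat.mul_lt_mul'' (by omega) (by omega)).trans_le b8
  have hBm : ∀ f : (ZMod p)[X], (natPoly m f).eval B < 2 ^ M := fun f =>
    ((coeffBound_natPoly m f).eval_lt (by omega)).trans_le
      ((Nat.pow_le_pow_right (by omega) (by omega)).trans hBM)
  have h3M : 3 < 2 ^ M := by omega
  have h2M : 2 < 2 ^ M := by omega
  simp [readProg, h3M, r4, hmM]
  refine (wp_packProg (B := B) (a := 3) (k := m) (by simp [r12]) (by simp [r7]) (by simp) (by simp)
    hM0 (fun j hj => ?_) (by omega) hBM b5 (by omega)).mono ?_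
  · simp only [Store.set_mem]
    rw [hu j (by omega)]
    have := hval (u.coeff j)
    omega
  rintro s₁ t₁ ⟨e1, f1, g1⟩
  have e1' : s₁.reg 62 = (natPoly m u).eval B := by
    rw [e1, eval_natPoly]
    refine Finset.sum_congr rfl fun j hj => ?_
    rw [← hu j (by have := Finset.mem_range.1 hj; omega)]
    rfl
  have h3m : s.mem (3 + m) = (u.coeff m).val := hu m (by omega)
  have hum : (u.coeff m).val < 2 ^ M := by have := hval (u.coeff m); omega
  have h3mM : 3 + m < 2 ^ M := by omega
  simp [e1', hBm, BinOp.eval, f1.1, f1.2, r4, hmM, h3M, h3m, h3mM, hum, r1, r13, hpM, h2M]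
  refine (wp_powProg (isMulProg_mod (p := p) hpp (by simp [f1.1, r1]) (by simp [f1.1, r12])
    (by simp [f1.1, r13])) (a := u.coeff m) (E := p - 2) (Agree.refl 40 _) (by simp)
    (by simp) (by omega)).mono ?_
  rintro s₂ t₂ ⟨e2, f2, g2⟩
  have hc1 : (u.coeff m ^ (p - 2)).val < 2 ^ M := (hval _).trans hpM
  have hc2 : (p - 1) * (u.coeff m ^ (p - 2)).val < 2 ^ M :=
    (Nat.mul_le_mul (Nat.sub_le _ _) (hval _).le).trans_lt hpp
  have hp1M : p - 1 < 2 ^ M := by omega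
  have h3mm : 3 + m + 1 < 2 ^ M := by omega
  simp [e2, BinOp.eval, f2.1, f1.1, r20, hc1, hc2, hp1M, hBm, r4, h3M, hmM, h3mM, r12, hM0]
  have hm2 : s₂.mem = s.mem := by simp [f2.2, f1.2]
  refine (wp_packProg (B := B) (a := m + 4) (k := m) (by simp [f2.1, f1.1, r12])
    (by simp [f2.1, f1.1, r7]) (by simp; omega) (by simp) hM0 (fun j hj => ?_) (by omega) hBM b5
    (by omega)).mono ?_
  · simp only [Store.set_mem, hm2]
    rw [hv j hj]
    have := hval (v.coeff j)
    omega
  rintro s₃ t₃ ⟨e3, f3, g3⟩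
  have e3' : s₃.reg 62 = (natPoly m v).eval B := by
    simp only [Store.set_mem, hm2] at e3
    rw [e3, eval_natPoly]
    exact Finset.sum_congr rfl fun j hj => by rw [hv j (Finset.mem_range.1 hj)]
  have h3m2 : 3 + m + m < 2 ^ M := by omega
  simp [e3', BinOp.eval, f3.1, f2.1, f1.1, hBm, r4, h3mM, hmM, h3m2, r12, hM0]
  have hm3 : s₃.mem = s.mem := by simp [f3.2, hm2]
  refine (wp_packProg (B := B) (a := 2 * m + 4) (k := m) (by simp [f3.1, f2.1, f1.1, r12])
    (by simp [f3.1, f2.1, f1.1, r7]) (by simp; omega) (by simp) hM0 (fun j hj => ?_) (by omega) hBM b5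
    (by omega)).mono ?_
  · simp only [Store.set_mem, hm3]
    rw [hw j hj]
    have := hval (w.coeff j)
    omega
  rintro s₄ t₄ ⟨e4, f4, g4⟩
  have e4' : s₄.reg 62 = (natPoly m w).eval B := by
    simp only [Store.set_mem, hm3] at e4
    rw [e4, eval_natPoly]
    exact Finset.sum_congr rfl fun j hj => by rw [hw j (Finset.mem_range.1 hj)]
  simp [e4', InputReady, NumbersReady, f4.1, f3.1, f2.1, f1.1, r1, r3, r4, r5, r6, r7, r8, r9, r12,
    r13, r17, r18, r20, hB, hm, hBm]
  omega

/-- A bound on the number of steps of the algorithm. -/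
def solveTime (M m n : ℕ) : ℕ :=
  3 * (M * (2 * (80 * m + 20) + 40) + 10) + 80 * m +
    3 * (n - 1) * (decodeTime M (80 * m + 20) n + 1) + 200

theorem wp_solveProg {K : Type*} [CommRing K] {p d n M y : ℕ} (hb : Bounds p d n M) {ζ g w : K}
    {enc : K → ℕ} (he : IsEncoding p (d * n) (((p ^ d) ^ n) ^ 8) ζ enc)
    (hy : IsReduction p (d * n) (((p ^ d) ^ n) ^ 8) ζ y) {s : Store} {t : ℕ}
    (hs : InputReady p d n y (enc g) (enc w) s) :
    Wp M solveProg t s fun s' t' =>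
      s'.reg 0 = ((decodeStep (p ^ d) n g)^[3 * (n - 1)] (w, 1, 0)).2.2 ∧
        t' ≤ t + solveTime M (d * n) n := by
  have hp2 := hb.two_le
  have hd := hb.d_pos
  have hn := hb.n_pos
  have b1 := hb.p_le
  have b2 := hb.pow_le
  have b3 := hb.lt_pow
  have b4 := hb.base_large
  have b5 := hb.base_lt
  have b7 := hb.n_le
  have b9 := hb.le_pow
  have b10 := hb.decode_lt
  obtain ⟨⟨r1, r3, r4, r5, r6, r7, r8, r9, r12, r13, r17, r18, r20⟩, r10, r14, r40⟩ := hs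
  have hred : ∀ c : Store, c.reg 1 = s.reg 1 → c.reg 4 = s.reg 4 → c.reg 7 = s.reg 7 →
      c.reg 8 = s.reg 8 → c.reg 9 = s.reg 9 → c.reg 10 = s.reg 10 → c.reg 12 = s.reg 12 →
      c.reg 13 = s.reg 13 → IsArithProg M (80 * (d * n) + 20) redProg c enc :=
    fun c h1 h4 h7 h8 h9 h10 h12 h13 => isArithProg_redProg he hy b9 (h1.trans r1) (h4.trans r4)
      (h7.trans r7) (h8.trans r8) (h9.trans r9) (h10.trans r10) (h12.trans r12) (h13.trans r13)
  have henc := (hred s rfl rfl rfl rfl rfl rfl rfl rfl).enc_lt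
  have hNM : (p ^ d) ^ n < 2 ^ M := by omega
  have hqM : p ^ d < 2 ^ M := by omega
  have h2M : 2 < 2 ^ M := by omega
  have hM0 : M ≠ 0 := by rintro rfl; omega
  simp [solveProg, BinOp.eval, r14, henc, r6, r13, hNM, h2M]
  refine (wp_powProg (hred _ (by simp) (by simp) (by simp) (by simp) (by simp) (by simp) (by simp)
    (by simp)).toIsMulProg (a := g) (E := (p ^ d) ^ n - 2) (Agree.refl 40 _) (by simp) (by simp)
    (by omega)).mono ?_
  rintro s₁ t₁ ⟨e1, f1, g1⟩
  simp [e1, henc, f1.1, BinOp.eval, r14, r5, r12, hqM, hM0]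
  refine (wp_powProg (hred _ (by simp [f1.1]) (by simp [f1.1]) (by simp [f1.1]) (by simp [f1.1])
    (by simp [f1.1]) (by simp [f1.1]) (by simp [f1.1])
    (by simp [f1.1])).toIsMulProg (a := g) (E := p ^ d - 1) (Agree.refl 40 _) (by simp) (by simp)
    (by omega)).mono ?_
  rintro s₂ t₂ ⟨e2, f2, g2⟩
  have hp1 : p - 1 < 2 ^ M := by omega
  simp [e2, henc, f2.1, f1.1, BinOp.eval, r20, hp1]
  refine (wp_redProg (c := s₂.set 100 0) (a := g ^ (p ^ d - 1) - 1) he hy b9 (by simp [f2.1, f1.1, r1])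
    (by simp [f2.1, f1.1, r4]) (by simp [f2.1, f1.1, r7]) (by simp [f2.1, f1.1, r8])
    (by simp [f2.1, f1.1, r9]) (by simp [f2.1, f1.1, r10]) (by simp [f2.1, f1.1, r12])
    (by simpa using Agree.refl 40 _) (by simpa using he.isPacked_sub_one _)).mono ?_
  rintro s₃ t₃ ⟨e3, f3, g3⟩
  simp [e3, henc, f3.1]
  refine (wp_decodeProg (hred _ ?_ ?_ ?_ ?_ ?_ ?_ ?_ ?_) (q := p ^ d) (D := n)
    (L := 3 * (n - 1)) ?_ ?_ g ?_ ?_ ?_ ?_ ?_ hqM ?_ ?_ b10 (w := w) (Agree.refl 40 _) ?_).mono ?_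
  all_goals try simp [f3.1, f2.1, f1.1, r3, r5, r17, r18, r40]
  · omega
  · omega
  · exact (Nat.pow_le_pow_right (by omega) (by omega)).trans_lt hNM
  · rintro s₄ t₄ e4 g4
    have := (decodeStep_bounds (q := p ^ d) (D := n) (by omega) g w (3 * (n - 1))).2
    rw [e4]
    refine ⟨?_, rfl, ?_⟩
    · rw [add_mul, one_mul] at b10
      omega
    · unfold solveTime
      omega

end RAM

/-! ### The layout of the input and the polynomial time bound. -/

theorem length_coeffList {p : ℕ} (m : ℕ) (f : (ZMod p)[X]) : (coeffList m f).length = m := by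
  simp [_root_.coeffList]

theorem getD_coeffList {p : ℕ} {m j : ℕ} (f : (ZMod p)[X]) (hj : j < m) :
    (coeffList m f).getD j 0 = (f.coeff j).val := by
  simp [_root_.coeffList, List.getD, List.getElem?_range hj]

theorem getD_dlogInput {p d n : ℕ} (u v w : (ZMod p)[X]) :
    (∀ j < d * n + 1, (dlogInput p d n u v w).getD (3 + j) 0 = (u.coeff j).val) ∧
    (∀ j < d * n, (dlogInput p d n u v w).getD (d * n + 4 + j) 0 = (v.coeff j).val) ∧
    ∀ j < d * n, (dlogInput p d n u v w).getD (2 * (d * n) + 4 + j) 0 = (w.coeff j).val := by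
  simp only [dlogInput]
  refine ⟨fun j hj => ?_, fun j hj => ?_, fun j hj => ?_⟩
  · rw [List.getD_append _ _ _ _ (by simp [length_coeffList]; omega),
      List.getD_append _ _ _ _ (by simp [length_coeffList]; omega),
      List.getD_append_right _ _ _ _ (by simp), ← getD_coeffList u hj]
    congr 1
    simp
  · rw [List.getD_append _ _ _ _ (by simp [length_coeffList]; omega),
      List.getD_append_right _ _ _ _ (by simp [length_coeffList]), ← getD_coeffList v hj]
    congr 1
    simp [length_coeffList]
  · rw [List.getD_append_right _ _ _ _ (by simp [length_coeffList]; omega), ← getD_coeffList w hj]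
    congr 1
    simp [length_coeffList]
    omega

namespace RAM

/-- With A = log₂(q^n) + 1, rounded down, the base is at most 2^(8A) and the exponent 2dn + 2 is at
most 2A, which gives 16A² bits. -/
theorem bounds_of_log {p d n : ℕ} (hp : 2 ≤ p) (hd : 1 ≤ d) (hn : 1 ≤ n) :
    d * n ≤ Nat.log 2 ((p ^ d) ^ n) ∧
      Bounds p d n (16 * (Nat.log 2 ((p ^ d) ^ n) + 1) ^ 2) := by
  have h1 : d * n ≤ Nat.log 2 ((p ^ d) ^ n) := by
    refine Nat.le_log_of_pow_le one_lt_two ?_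
    rw [← pow_mul p]
    exact Nat.pow_le_pow_left hp _
  refine ⟨h1, hp, hd, hn, ?_⟩
  have h2 := Nat.lt_pow_succ_log_self one_lt_two ((p ^ d) ^ n)
  generalize Nat.log 2 ((p ^ d) ^ n) = l at *
  generalize (p ^ d) ^ n = N at *
  calc (N ^ 8) ^ (2 * (d * n) + 2) ≤ ((2 ^ (l + 1)) ^ 8) ^ (2 * (d * n) + 2) := by gcongr
    _ ≤ ((2 ^ (l + 1)) ^ 8) ^ (2 * (l + 1)) := Nat.pow_le_pow_right (by positivity) (by omega)
    _ = 2 ^ (16 * (l + 1) ^ 2) := by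
      rw [← pow_mul, ← pow_mul]
      congr 1
      ring

/-- The decoding dominates: 3(n - 1) rounds, n powers in each trace, O(A²) multiplications per power
and O(A) steps per reduction. -/
theorem steps_le {A m n : ℕ} (hA : 1 ≤ A) (hm : m ≤ A) (hn : n ≤ A) :
    60 * m + 200 + (60 * m + 16 * A ^ 2 * 50 + 200) + solveTime (16 * A ^ 2) m n + 10 ≤
      40000 * A ^ 5 := by
  have hT : 80 * m + 20 ≤ 100 * A := by omega
  have h1 : A ≤ A ^ 2 := Nat.le_self_pow (by omega) A
  have h2 : A ^ 2 ≤ A ^ 3 := Nat.pow_le_pow_right hA (by omega)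
  have h3 : A ^ 3 ≤ A ^ 4 := Nat.pow_le_pow_right hA (by omega)
  have h4 : A ^ 4 ≤ A ^ 5 := Nat.pow_le_pow_right hA (by omega)
  have hpow : 16 * A ^ 2 * (2 * (80 * m + 20) + 40) + 10 ≤ 3850 * A ^ 3 := by
    have : 16 * A ^ 2 * (2 * (80 * m + 20) + 40) ≤ 16 * A ^ 2 * (240 * A) :=
      Nat.mul_le_mul_left _ (by omega)
    have h5 : 16 * A ^ 2 * (240 * A) = 3840 * A ^ 3 := by ring
    omega
  have hdec : decodeTime (16 * A ^ 2) (80 * m + 20) n + 1 ≤ 8100 * A ^ 4 := by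
    unfold decodeTime
    have : n * ((80 * m + 20) + (16 * A ^ 2 * (2 * (80 * m + 20) + 40) + 10) + 31) ≤
        A * (3981 * A ^ 3) := Nat.mul_le_mul hn (by omega)
    have h5 : A * (3981 * A ^ 3) = 3981 * A ^ 4 := by ring
    omega
  have hmain : 3 * (n - 1) * (decodeTime (16 * A ^ 2) (80 * m + 20) n + 1) ≤
      3 * A * (8100 * A ^ 4) := Nat.mul_le_mul (by omega) hdec
  have h5 : 3 * A * (8100 * A ^ 4) = 24300 * A ^ 5 := by ring
  unfold solveTime
  omega

theorem finds_dlogProg {p d n : ℕ} [hp : Fact p.Prime] (u : (ZMod p)[X]) [hu : Fact (Irreducible u)]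
    (g : AdjoinRoot u) (e : ℕ) (v w : (ZMod p)[X]) (hud : u.natDegree = d * n)
    (hv : v.degree < u.degree) (hvg : AdjoinRoot.mk u v = g)
    (hw : w.degree < u.degree) (hwg : AdjoinRoot.mk u w = g ^ e)
    (he : ((decodeStep (p ^ d) n g)^[3 * (n - 1)] (g ^ e, 1, 0)).2.2 = e) :
    FindsInExpectedTime dlogProg (dlogInput p d n u v w) e
      (11560000 * (Nat.log 2 ((p ^ d) ^ n) + 1) ^ 9) := by
  have hdn : 0 < d * n := hud ▸ hu.out.natDegree_pos
  have hd : 1 ≤ d := Nat.pos_of_mul_pos_right hdn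
  have hn : 1 ≤ n := Nat.pos_of_mul_pos_left hdn
  obtain ⟨hm, hb⟩ := bounds_of_log hp.out.two_le hd hn
  obtain ⟨i1, i2, i3⟩ := getD_dlogInput (d := d) (n := n) u v w
  have hnA := hb.n_le
  generalize hA : Nat.log 2 ((p ^ d) ^ n) + 1 = A at *
  have henc : IsEncoding p (d * n) (((p ^ d) ^ n) ^ 8) (AdjoinRoot.root u)
      (encode u (((p ^ d) ^ n) ^ 8)) := by
    rw [← hud]
    exact isEncoding_encode u (by rw [hud]; exact hb.lt_base)
  have hred : IsReduction p (d * n) (((p ^ d) ^ n) ^ 8) (AdjoinRoot.root u)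
      ((p - 1) * (u.coeff (d * n) ^ (p - 2)).val *
        (natPoly (d * n) u).eval (((p ^ d) ^ n) ^ 8)) := by
    rw [← hud]
    refine isReduction_natPoly u ?_ (ZMod.val_lt _).le
    have h2 := hp.out.two_le
    rw [ZMod.natCast_zmod_val, ← leadingCoeff, ← pow_succ, show p - 2 + 1 = p - 1 by omega]
    exact ZMod.pow_card_sub_one_eq_one (leadingCoeff_ne_zero.2 hu.out.ne_zero)
  have hvE : (natPoly (d * n) v).eval (((p ^ d) ^ n) ^ 8) = encode u (((p ^ d) ^ n) ^ 8) g := by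
    rw [← hvg, encode_mk u _ hv, hud]
  have hwE : (natPoly (d * n) w).eval (((p ^ d) ^ n) ^ 8) =
      encode u (((p ^ d) ^ n) ^ 8) (g ^ e) := by
    rw [← hwg, encode_mk u _ hw, hud]
  have hrun : Wp (16 * A ^ 2) dlogProg 0
      ⟨fun _ => 0, fun i => (dlogInput p d n u v w).getD i 0⟩
      fun s' t' => s'.reg 0 = e ∧ t' ≤ 40000 * A ^ 5 := by
    simp only [dlogProg, wp_block_cons, wp_block_nil]
    refine (wp_numbersProg hb rfl rfl rfl).mono fun s₁ t₁ ⟨a1, a2, a3⟩ => ?_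
    refine (wp_readProg hb a1 u v w ?_ ?_ ?_).mono fun s₂ t₂ ⟨b1, b2⟩ => ?_
    · simpa only [a2] using i1
    · simpa only [a2] using i2
    · simpa only [a2] using i3
    · rw [hvE, hwE] at b1
      refine (wp_solveProg hb henc hred b1).mono fun s₃ t₃ ⟨c1, c2⟩ => ⟨c1.trans he, ?_⟩
      have := steps_le (A := A) (m := d * n) (n := n) (by omega) (by omega) (by omega)
      omega
  obtain ⟨s', N, hexec, hres, hN⟩ := hrun
  rw [zero_add] at hN
  rw [← hres]
  refine hexec.findsInExpectedTime ?_
  have hA1 : 1 ≤ A ^ 2 := Nat.one_le_pow _ _ (by omega)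
  -- At most 40000 A⁵ steps, each of cost at most (17A²)² = 289 A⁴.
  calc N * (16 * A ^ 2 + 1) ^ 2 ≤ 40000 * A ^ 5 * (17 * A ^ 2) ^ 2 := by
        gcongr
        omega
    _ = 11560000 * A ^ 9 := by ring

end RAM

/-! ### Assembly of the theorem. -/

/-- Counting the elements of the field over 𝔽_p and over F gives (p^d)^n = (p^d)^[K : F]. -/
theorem finrank_eq_of_natCard_subfield {p d n : ℕ} [hp : Fact p.Prime] (u : (ZMod p)[X])
    [hu : Fact (Irreducible u)] (F : Subfield (AdjoinRoot u)) [Finite F]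
    (hud : u.natDegree = d * n) (hF : Nat.card F = p ^ d) :
    Module.finrank F (AdjoinRoot u) = n := by
  have hd : 0 < d * n := hud ▸ hu.out.natDegree_pos
  let b := AdjoinRoot.powerBasis hu.out.ne_zero
  have hfin : Module.Finite (ZMod p) (AdjoinRoot u) := b.finite
  have hK : Nat.card (AdjoinRoot u) = p ^ (d * n) := by
    rw [Module.natCard_eq_pow_finrank (K := ZMod p), Nat.card_zmod, b.finrank,
      AdjoinRoot.powerBasis_dim, hud]
  have hKfin : Finite (AdjoinRoot u) := Module.finite_of_finite (ZMod p)
  have hFK : Module.Finite F (AdjoinRoot u) := Module.Finite.of_finite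
  have h1 := Module.natCard_eq_pow_finrank (K := F) (V := AdjoinRoot u)
  rw [hK, hF, pow_mul] at h1
  refine (Nat.pow_right_injective ?_ h1).symm
  exact hp.out.two_le.trans (Nat.le_self_pow (Nat.pos_of_mul_pos_right hd).ne' _)

theorem theorem1 :
    (∃ (P : RAM.Prog) (f : ℕ[X]),
      ∀ (p d n : ℕ) [Fact p.Prime] (u : (ZMod p)[X]) [Fact (Irreducible u)]
        (F : Subfield (AdjoinRoot u)) (g : AdjoinRoot u) (e : ℕ) (v w : (ZMod p)[X]),
        u.natDegree = d * n →
        Nat.card F = p ^ d →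
        n ∣ p ^ d - 1 →
        IsKummerShift F n g →
        e < (p ^ d) ^ n →
        digitSum (p ^ d) e < n →
        v.degree < u.degree → AdjoinRoot.mk u v = g →
        w.degree < u.degree → AdjoinRoot.mk u w = g ^ e →
        RAM.FindsInExpectedTime P (dlogInput p d n u v w) e
          (f.eval (Nat.log 2 ((p ^ d) ^ n)))) ∧
    (∀ (F K : Type*) [Field F] [Finite F] [Field K] [Algebra F K] (n : ℕ) (g : K) (e e' : ℕ),
        Module.finrank F K = n →
        n ∣ Nat.card F - 1 →
        IsKummerShift F n g →
        e < Nat.card F ^ n → digitSum (Nat.card F) e < n →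
        e' < Nat.card F ^ n → digitSum (Nat.card F) e' < n →
        g ^ e' = g ^ e →
        e' = e) := by
  refine ⟨⟨RAM.dlogProg, 11560000 * (X + 1) ^ 9, ?_⟩, ?_⟩
  · intro p d n hp u hu F g e v w hud hF hdvd hg he hs hv hvg hw hwg
    have hFfin : Finite F := Nat.finite_of_card_ne_zero (by
      rw [hF]; exact pow_ne_zero _ hp.out.ne_zero)
    have hn := finrank_eq_of_natCard_subfield u F hud hF
    rw [← hF] at hdvd he hs
    have hdec := decode_eq hn hdvd hg he hs
    rw [hF] at hdec
    simpa using RAM.finds_dlogProg u g e v w hud hv hvg hw hwg hdec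
  · intro F K _ _ _ _ n g e e' hn hdvd hg he hs he' hs' h
    exact eq_of_pow_eq_pow hn hdvd hg he hs he' hs' h
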